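/- Let $V$ be a finite set of nodes, fix a node $v$, let $p_d(\cdot|v)$ and $p_n(\cdot|v)$ be probability distributions on $V$ with $p_d(u|v)>0$ and $p_n(u|v)>0$ for all $u\in V$, and let $k\ge 1$ be an integer. Put $\sigma(x)=1/(1+e^{-x})$ and regard the inner products $\theta_u=\mathbf u^\top\mathbf v$ of the embeddings, $u\in V$, as free parameters $\theta\in\mathbb R^V$. Let $\theta^*$ be the maximizer over $\mathbb R^V$ of $$J(\theta)=\sum_{u}p_d(u|v)\log\sigma(\theta_u)+k\sum_{u}p_n(u|v)\log\sigma(-\theta_u).$$ Let $u_1,u_2,\dots$ be samples from $p_d(\cdot|v)$ and $u_1',u_2',\dots$ samples from $p_n(\cdot|v)$, all mutually independent, and let $\theta_T$ be a measurable random vector that is, almost surely, a maximizer over $\mathbb R^V$ of $$J_T(\theta)=\frac1T\sum_{i=1}^{T}\log\sigma(\theta_{u_i})+\frac1T\sum_{i=1}^{kT}\log\sigma(-\theta_{u_i'})$$ whenever $J_T$ has a maximizer (and is arbitrary otherwise). Let $E_T$ be the event that $J_T$ has exactly one maximizer. Then: 1. $\mathbb P(E_T)\to1$ as $T\to\infty$.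 2. As $T\to\infty$, $\sqrt T(\theta_T-\theta^*)$ converges in distribution to a probability distribution on $\mathbb R^V$ with finite second moments, mean vector zero and covariance matrix $$\operatorname{diag}(m)^{-1}-\Big(1+\frac1k\Big)\mathbf 1\mathbf 1^\top,\qquad m_u=\frac{k\,p_d(u|v)\,p_n(u|v)}{p_d(u|v)+k\,p_n(u|v)},$$ where $\mathbf 1\mathbf 1^\top$ is the all-ones matrix. 3. For every $u\in V$, the risk of $\theta_u$ (its mean squared error, which is finite given $E_T$) is, to leading order, $\frac1T\big(\frac1{p_d(u|v)}-1+\frac1{k\,p_n(u|v)}-\frac1k\big)$; precisely, $$\lim_{T\to\infty}T\;\mathbb E\big[\,|(\theta_T-\theta^*)_u|^2\;\big|\;E_T\big]=\frac1{p_d(u|v)}-1+\frac1{k\,p_n(u|v)}-\frac1k .$$ -/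

import Mathlib

open MeasureTheory ProbabilityTheory Filter Topology

namespace SampledNCE

noncomputable section

/-- The population objective of a fixed central node `v`, as a function of the free parameters
`θ u = uᵀ v`. Here `pd` and `pn` are the conditional distributions `p_d(· | v)` and `p_n(· | v)`
on the nodes, and `k` is the number of negative samples per positive one:
`E_{u ∼ p_d} log σ(θ_u) + k E_{u' ∼ p_n} log σ(-θ_{u'})`. -/
def objective {V : Type*} [Fintype V] (pd pn : PMF V) (k : ℕ) (θ : EuclideanSpace ℝ V) : ℝ :=
  (∑ u, (pd u).toReal * Real.log (Real.sigmoid (θ u)))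
    + k * ∑ u, (pn u).toReal * Real.log (Real.sigmoid (-θ u))

/-- The empirical objective built from the `T` positive samples `x 0, …, x (T - 1)` and the
`k * T` negative samples `y 0, …, y (k * T - 1)`. -/
def empiricalObjective {V : Type*} (k T : ℕ) (x y : ℕ → V) (θ : EuclideanSpace ℝ V) : ℝ :=
  (1 / (T : ℝ)) * (∑ i ∈ Finset.range T, Real.log (Real.sigmoid (θ (x i))))
    + (1 / (T : ℝ)) * ∑ i ∈ Finset.range (k * T), Real.log (Real.sigmoid (-θ (y i)))

/-- `θ` is a global maximizer of `J`. -/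
def IsMaximizer {V : Type*} (J : EuclideanSpace ℝ V → ℝ) (θ : EuclideanSpace ℝ V) : Prop :=
  IsMaxOn J Set.univ θ

/-- The event that the empirical objective has exactly one global maximizer. With positive
probability some node is missing among the samples, and then there is no such maximizer. -/
def uniqueOptimumEvent {V Ω : Type*} (k T : ℕ) (X Y : ℕ → Ω → V) : Set Ω :=
  {ω | ∃! θ : EuclideanSpace ℝ V,
    IsMaximizer (empiricalObjective k T (fun i => X i ω) (fun i => Y i ω)) θ}

/-- The vector `m`, with `m_u = k p_d(u|v) p_n(u|v) / (p_d(u|v) + k p_n(u|v))`. -/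
def weight {V : Type*} (pd pn : PMF V) (k : ℕ) (u : V) : ℝ :=
  (k * (pd u).toReal * (pn u).toReal) / ((pd u).toReal + k * (pn u).toReal)

/-- The matrix `diag(m)⁻¹ - (1 + 1/k) J`, where `J` is the all-ones matrix. -/
def asymptoticCovariance {V : Type*} [Fintype V] [DecidableEq V] (pd pn : PMF V) (k : ℕ) :
    Matrix V V ℝ :=
  (Matrix.diagonal (weight pd pn k))⁻¹ - (1 + 1 / (k : ℝ)) • Matrix.of (fun _ _ : V => (1 : ℝ))

end

end SampledNCE

/-!
For weights `a, b > 0` the concave function `a log σ(t) + b log σ(-t)` has the unique maximizer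
`log (a / b)`, by Gibbs' inequality for Bernoulli distributions, and if `a` or `b` vanishes it is
monotone. Both objectives are sums over the nodes of such functions. Hence the population optimum is
`θ*_u = log (p_d(u) / (k p_n(u)))`, the empirical optimum is the logarithm of the ratio of the
numbers of occurrences of `u` in the two samples, and it exists uniquely exactly when every node
occurs in both samples. With `x_u`, `y_u` the relative errors of the empirical frequencies in the
positive and negative sample (`freqError`), on that event
`(θ_T - θ*)_u = log (1 + x_u) - log (1 + y_u)`.

The linear part `x - y` is treated exactly. `√T (x - y)` is a normalized sum of independent vectors,
so that its characteristic function converges to that of the centred Gaussian law with the claimed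
covariance matrix (`tendstoInDistribution_linearError`), and its coordinates have the claimed second
moment for every `T ≥ 1` (`integral_linearError_sq`).

The remainder is controlled by one quantity, the sum `Q` of the fourth powers of all relative errors
(`quarticError`), whose mean is `O(T⁻²)` (`integral_quarticError_le`). If `u` occurs among `n`
samples, `1 + x_u ≥ 1 / n`, so that `log (1 + x_u) - x_u` is at most of order `x_u ^ 2 log n`;
and if a node is missing, its relative error is `-1`, hence `Q ≥ 1`. Consequently the probability
that some node is missing is `O(T⁻²)`, and the mean square of `√T` times the remainder, where
`θ_T - θ*` is replaced by `0` if a node is missing, is `O((log T) ^ 2 / T)`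
(`tendsto_integral_sq_truncatedError_sub`). This transfers both the limit law, by Slutsky's theorem,
and the second moments from the linear part to `θ_T - θ*`.
-/

namespace SampledNCE

/-! ### Weighted logistic likelihoods -/

/-- The separable logistic log-likelihood `∑ u, (a u log σ(θ u) + b u log σ(-θ u))` with weights
`a u` for the positive label and `b u` for the negative one. -/
noncomputable def logLikelihood {V : Type*} [Fintype V] (a b : V → ℝ)
    (θ : EuclideanSpace ℝ V) : ℝ :=
  ∑ u, (a u * Real.log (Real.sigmoid (θ u)) + b u * Real.log (Real.sigmoid (-θ u)))

lemma sigmoid_log_div {a b : ℝ} (ha : 0 < a) (hb : 0 < b) :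
    Real.sigmoid (Real.log (a / b)) = a / (a + b) := by
  rw [Real.sigmoid_def, ← Real.log_inv, Real.exp_log (by positivity)]
  field_simp

/-- Gibbs' inequality for a Bernoulli distribution, in the logistic parametrization. -/
lemma logistic_lt_of_ne {a b t : ℝ} (ha : 0 < a) (hb : 0 < b) (ht : t ≠ Real.log (a / b)) :
    a * Real.log (Real.sigmoid t) + b * Real.log (Real.sigmoid (-t)) <
      a * Real.log (Real.sigmoid (Real.log (a / b))) +
        b * Real.log (Real.sigmoid (-Real.log (a / b))) := by
  have hne : Real.sigmoid t ≠ a / (a + b) := by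
    rw [← sigmoid_log_div ha hb]
    exact fun h ↦ ht (Real.sigmoid_injective h)
  have h0 := Real.sigmoid_pos t
  have h1 := Real.sigmoid_lt_one t
  rw [Real.sigmoid_neg, Real.sigmoid_neg, sigmoid_log_div ha hb]
  set s := Real.sigmoid t
  have hs : 0 < 1 - s := by linarith
  have hq : 1 - a / (a + b) = b / (a + b) := by field_simp; ring
  rw [hq]
  have e1 : Real.log (s / (a / (a + b))) < s / (a / (a + b)) - 1 :=
    Real.log_lt_sub_one_of_pos (by positivity) fun h ↦ hne (by
      rwa [div_eq_one_iff_eq (by positivity)] at h)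
  have e2 : Real.log ((1 - s) / (b / (a + b))) ≤ (1 - s) / (b / (a + b)) - 1 :=
    Real.log_le_sub_one_of_pos (by positivity)
  rw [Real.log_div h0.ne' (by positivity)] at e1
  rw [Real.log_div hs.ne' (by positivity)] at e2
  have e3 : a * (s / (a / (a + b)) - 1) + b * ((1 - s) / (b / (a + b)) - 1) = 0 := by
    field_simp; ring
  nlinarith [mul_lt_mul_of_pos_left e1 ha, mul_le_mul_of_nonneg_left e2 hb.le]

/-- The number of times that `u` occurs among `z 0, …, z (n - 1)`. -/
def occurrences {V : Type*} [DecidableEq V] (z : ℕ → V) (n : ℕ) (u : V) : ℕ :=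
  ∑ i ∈ Finset.range n, if z i = u then 1 else 0

lemma occurrences_le {V : Type*} [DecidableEq V] (z : ℕ → V) (n : ℕ) (u : V) :
    occurrences z n u ≤ n := by
  refine (Finset.sum_le_card_nsmul _ _ 1 fun i _ ↦ ?_).trans (by simp)
  split_ifs <;> simp

section Likelihood

variable {V : Type*} [Fintype V]

lemma isMaximizer_logLikelihood_iff {a b : V → ℝ} (ha : ∀ u, 0 < a u) (hb : ∀ u, 0 < b u)
    {θ : EuclideanSpace ℝ V} :
    IsMaximizer (logLikelihood a b) θ ↔ ∀ u, θ u = Real.log (a u / b u) := by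
  have key (t : ℝ) (u : V) :
      a u * Real.log (Real.sigmoid t) + b u * Real.log (Real.sigmoid (-t)) ≤
        a u * Real.log (Real.sigmoid (Real.log (a u / b u))) +
          b u * Real.log (Real.sigmoid (-Real.log (a u / b u))) := by
    by_cases ht : t = Real.log (a u / b u)
    · rw [ht]
    · exact (logistic_lt_of_ne (ha u) (hb u) ht).le
  constructor
  · intro h
    by_contra! hu
    obtain ⟨u, hu⟩ := hu
    have h1 : logLikelihood a b θ <
        logLikelihood a b (WithLp.toLp 2 fun u ↦ Real.log (a u / b u)) :=
      Finset.sum_lt_sum (fun w _ ↦ key _ w)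
        ⟨u, Finset.mem_univ u, logistic_lt_of_ne (ha u) (hb u) hu⟩
    exact absurd (isMaxOn_iff.1 h _ (Set.mem_univ _)) h1.not_ge
  · intro h ϑ _
    change logLikelihood a b ϑ ≤ logLikelihood a b θ
    refine Finset.sum_le_sum fun u _ ↦ ?_
    rw [h u]
    exact key _ u

/-- If a node has a vanishing weight, its coordinate can be shifted in one direction without
decreasing the likelihood, so that no maximizer is isolated. -/
lemma not_existsUnique_isMaximizer_logLikelihood [DecidableEq V] {a b : V → ℝ} (ha : ∀ u, 0 ≤ a u)
    (hb : ∀ u, 0 ≤ b u) {u : V} (hu : a u = 0 ∨ b u = 0) :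
    ¬ ∃! θ, IsMaximizer (logLikelihood a b) θ := by
  rintro ⟨θ, hθ, huniq⟩
  obtain ⟨s, hs, hle⟩ : ∃ s : ℝ, s ≠ θ u ∧
      a u * Real.log (Real.sigmoid (θ u)) + b u * Real.log (Real.sigmoid (-θ u)) ≤
        a u * Real.log (Real.sigmoid s) + b u * Real.log (Real.sigmoid (-s)) := by
    rcases hu with h | h
    · refine ⟨θ u - 1, by simp, ?_⟩
      rw [h, zero_mul, zero_mul, zero_add, zero_add]
      exact mul_le_mul_of_nonneg_left (Real.log_le_log (Real.sigmoid_pos _)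
        (Real.sigmoid_le (by linarith))) (hb u)
    · refine ⟨θ u + 1, by simp, ?_⟩
      rw [h, zero_mul, zero_mul, add_zero, add_zero]
      exact mul_le_mul_of_nonneg_left (Real.log_le_log (Real.sigmoid_pos _)
        (Real.sigmoid_le (by linarith))) (ha u)
  set θ' : EuclideanSpace ℝ V := WithLp.toLp 2 (Function.update (fun w ↦ θ w) u s)
  have hval (w : V) : θ' w = if w = u then s else θ w := by
    simp [θ', Function.update_apply]
  have hge : logLikelihood a b θ ≤ logLikelihood a b θ' := by
    refine Finset.sum_le_sum fun w _ ↦ ?_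
    rw [hval]
    split_ifs with hw
    · rw [hw]; exact hle
    · exact le_rfl
  have := huniq θ' fun ϑ hϑ ↦ (hθ hϑ).trans hge
  apply hs
  rw [← this, hval, if_pos rfl]

lemma sum_range_eq_sum_occurrences [DecidableEq V] (z : ℕ → V) (n : ℕ) (f : V → ℝ) :
    ∑ i ∈ Finset.range n, f (z i) = ∑ u, (occurrences z n u : ℝ) * f u := by
  simp_rw [occurrences, Nat.cast_sum, Finset.sum_mul]
  rw [Finset.sum_comm]
  simp

lemma objective_eq_logLikelihood (pd pn : PMF V) (k : ℕ) :
    objective pd pn k =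
      logLikelihood (fun u ↦ (pd u).toReal) (fun u ↦ k * (pn u).toReal) := by
  ext θ
  simp only [objective, logLikelihood, Finset.sum_add_distrib, Finset.mul_sum, mul_assoc]

lemma empiricalObjective_eq_logLikelihood [DecidableEq V] (k T : ℕ) (x y : ℕ → V) :
    empiricalObjective k T x y =
      logLikelihood (fun u ↦ (occurrences x T u : ℝ) / T)
        (fun u ↦ (occurrences y (k * T) u : ℝ) / T) := by
  ext θ
  simp only [empiricalObjective, logLikelihood, Finset.sum_add_distrib]
  rw [sum_range_eq_sum_occurrences x T (fun u ↦ Real.log (Real.sigmoid (θ u))),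
    sum_range_eq_sum_occurrences y (k * T) (fun u ↦ Real.log (Real.sigmoid (-θ u))),
    Finset.mul_sum, Finset.mul_sum]
  congr 1 <;> exact Finset.sum_congr rfl fun u _ ↦ by ring

lemma isMaximizer_objective_iff {pd pn : PMF V} (hpd : ∀ u, 0 < (pd u).toReal)
    (hpn : ∀ u, 0 < (pn u).toReal) {k : ℕ} (hk : 1 ≤ k) {θ : EuclideanSpace ℝ V} :
    IsMaximizer (objective pd pn k) θ ↔
      ∀ u, θ u = Real.log ((pd u).toReal / (k * (pn u).toReal)) := by
  have : (0 : ℝ) < k := by exact_mod_cast hk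
  rw [objective_eq_logLikelihood]
  exact isMaximizer_logLikelihood_iff hpd fun u ↦ mul_pos this (hpn u)

lemma isMaximizer_empiricalObjective_iff [DecidableEq V] [Nonempty V] {k T : ℕ} {x y : ℕ → V}
    (hx : ∀ u, 0 < occurrences x T u) (hy : ∀ u, 0 < occurrences y (k * T) u)
    {θ : EuclideanSpace ℝ V} :
    IsMaximizer (empiricalObjective k T x y) θ ↔
      ∀ u, θ u = Real.log (occurrences x T u / occurrences y (k * T) u) := by
  have hT : (0 : ℝ) < T := by
    have u : V := Classical.arbitrary V
    exact_mod_cast (hx u).trans_le (occurrences_le x T u)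
  have hx' u : (0 : ℝ) < occurrences x T u := by exact_mod_cast hx u
  have hy' u : (0 : ℝ) < occurrences y (k * T) u := by exact_mod_cast hy u
  rw [empiricalObjective_eq_logLikelihood, isMaximizer_logLikelihood_iff
    (fun u ↦ div_pos (hx' u) hT) (fun u ↦ div_pos (hy' u) hT)]
  simp_rw [div_div_div_cancel_right₀ hT.ne']

/-- The empirical objective has a unique maximizer exactly when every node occurs among the
positive and among the negative samples. -/
lemma existsUnique_isMaximizer_empiricalObjective_iff [DecidableEq V] [Nonempty V] {k T : ℕ}
    {x y : ℕ → V} :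
    (∃! θ, IsMaximizer (empiricalObjective k T x y) θ) ↔
      ∀ u, 0 < occurrences x T u ∧ 0 < occurrences y (k * T) u := by
  constructor
  · contrapose!
    rintro ⟨u, hu⟩
    rw [empiricalObjective_eq_logLikelihood]
    refine not_existsUnique_isMaximizer_logLikelihood (u := u) (fun _ ↦ by positivity)
      (fun _ ↦ by positivity) ?_
    by_cases h : 0 < occurrences x T u
    · right; simp [Nat.le_zero.1 (hu h)]
    · left; simp [Nat.eq_zero_of_not_pos h]
  · intro h
    have hmax θ := isMaximizer_empiricalObjective_iff (k := k) (θ := θ) (fun u ↦ (h u).1)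
      (fun u ↦ (h u).2)
    refine ⟨WithLp.toLp 2 fun u ↦ Real.log (occurrences x T u / occurrences y (k * T) u),
      (hmax _).2 fun u ↦ rfl, fun θ hθ ↦ ?_⟩
    ext u
    exact (hmax _).1 hθ u

end Likelihood

/-! ### Moments of sums of independent centred variables -/

lemma abs_sum_range_le {Ω : Type*} {ξ : ℕ → Ω → ℝ} {c : ℝ} (hb : ∀ i ω, |ξ i ω| ≤ c) (n : ℕ)
    (ω : Ω) : |∑ i ∈ Finset.range n, ξ i ω| ≤ n * c := by
  refine (Finset.abs_sum_le_sum_abs _ _).trans ?_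
  refine (Finset.sum_le_card_nsmul _ _ c fun i _ ↦ hb i ω).trans ?_
  simp

section Moments

variable {Ω : Type*} [MeasurableSpace Ω] {μ : Measure Ω} {ξ : ℕ → Ω → ℝ} {c : ℝ}

lemma integrable_pow_mul_pow [IsFiniteMeasure μ] {f g : Ω → ℝ} {c d : ℝ} (hf : AEMeasurable f μ)
    (hg : AEMeasurable g μ) (hfb : ∀ ω, |f ω| ≤ c) (hgb : ∀ ω, |g ω| ≤ d) (m n : ℕ) :
    Integrable (fun ω ↦ f ω ^ m * g ω ^ n) μ := by
  refine Integrable.of_bound ((hf.pow_const m).mul (hg.pow_const n)).aestronglyMeasurable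
    (c ^ m * d ^ n) (ae_of_all _ fun ω ↦ ?_)
  have hc := (abs_nonneg _).trans (hfb ω)
  rw [Real.norm_eq_abs, abs_mul, abs_pow, abs_pow]
  gcongr
  · exact hfb ω
  · exact hgb ω

lemma integral_sum_range_pow_mul_pow (hindep : iIndepFun ξ μ) (hm : ∀ i, AEMeasurable (ξ i) μ)
    (n a b : ℕ) :
    ∫ ω, (∑ i ∈ Finset.range n, ξ i ω) ^ a * ξ n ω ^ b ∂μ =
      (∫ ω, (∑ i ∈ Finset.range n, ξ i ω) ^ a ∂μ) * ∫ ω, ξ n ω ^ b ∂μ := by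
  have h := (hindep.indepFun_sum_range_succ₀ hm n).comp (φ := fun x : ℝ ↦ x ^ a)
    (ψ := fun x : ℝ ↦ x ^ b) (by fun_prop) (by fun_prop)
  have hS : AEMeasurable (∑ i ∈ Finset.range n, ξ i) μ :=
    Finset.aemeasurable_sum _ fun i _ ↦ hm i
  have := h.integral_fun_mul_eq_mul_integral (hS.pow_const a).aestronglyMeasurable
    ((hm n).pow_const b).aestronglyMeasurable
  simpa using this

lemma integral_sum_range_sq [IsProbabilityMeasure μ] (hindep : iIndepFun ξ μ)
    (hm : ∀ i, AEMeasurable (ξ i) μ) (hb : ∀ i ω, |ξ i ω| ≤ c) (h0 : ∀ i, ∫ ω, ξ i ω ∂μ = 0)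
    (n : ℕ) :
    ∫ ω, (∑ i ∈ Finset.range n, ξ i ω) ^ 2 ∂μ = ∑ i ∈ Finset.range n, ∫ ω, ξ i ω ^ 2 ∂μ := by
  induction n with
  | zero => simp
  | succ n ih =>
    have hS : AEMeasurable (fun ω ↦ ∑ i ∈ Finset.range n, ξ i ω) μ :=
      Finset.aemeasurable_fun_sum _ fun i _ ↦ hm i
    have I := integrable_pow_mul_pow hS (hm n) (abs_sum_range_le hb n) (hb n)
    have e (ω : Ω) : (∑ i ∈ Finset.range (n + 1), ξ i ω) ^ 2 =
        (∑ i ∈ Finset.range n, ξ i ω) ^ 2 * ξ n ω ^ 0 +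
          2 * ((∑ i ∈ Finset.range n, ξ i ω) ^ 1 * ξ n ω ^ 1) +
          (∑ i ∈ Finset.range n, ξ i ω) ^ 0 * ξ n ω ^ 2 := by
      rw [Finset.sum_range_succ]; ring
    simp_rw [e]
    rw [integral_add ((I 2 0).fun_add ((I 1 1).const_mul 2)) (I 0 2),
      integral_add (I 2 0) ((I 1 1).const_mul 2), integral_const_mul,
      integral_sum_range_pow_mul_pow hindep hm n 1 1, Finset.sum_range_succ, ← ih]
    simp [h0]

/-- The fourth moment of a sum of `n` centred independent variables bounded by `c` is of order
`n ^ 2`: in the expansion of `(S + ξ) ^ 4` the terms with a factor `ξ` or `S` of exponent one have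
mean zero. -/
lemma integral_sum_range_pow_four_le [IsProbabilityMeasure μ] (hindep : iIndepFun ξ μ)
    (hm : ∀ i, AEMeasurable (ξ i) μ) (hb : ∀ i ω, |ξ i ω| ≤ c) (h0 : ∀ i, ∫ ω, ξ i ω ∂μ = 0)
    (n : ℕ) :
    ∫ ω, (∑ i ∈ Finset.range n, ξ i ω) ^ 4 ∂μ ≤ 3 * n ^ 2 * c ^ 4 := by
  have hpow (i m : ℕ) : ∫ ω, ξ i ω ^ m ∂μ ≤ c ^ m := by
    have h : ∫ ω, ξ i ω ^ m ∂μ ≤ ∫ _, c ^ m ∂μ := by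
      refine integral_mono ?_ (integrable_const _) fun ω ↦ ?_
      · simpa using integrable_pow_mul_pow (hm i) (hm i) (hb i) (hb i) m 0
      · refine (le_abs_self _).trans ?_
        rw [abs_pow]
        gcongr
        exact hb i ω
    simpa using h
  have hsq (n : ℕ) : ∫ ω, (∑ i ∈ Finset.range n, ξ i ω) ^ 2 ∂μ ≤ n * c ^ 2 := by
    rw [integral_sum_range_sq hindep hm hb h0]
    refine (Finset.sum_le_card_nsmul _ _ (c ^ 2) fun i _ ↦ hpow i 2).trans ?_
    simp
  have h1 (n : ℕ) : ∫ ω, ∑ i ∈ Finset.range n, ξ i ω ∂μ = 0 := by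
    rw [integral_finsetSum _ fun i _ ↦
      by simpa using integrable_pow_mul_pow (hm i) (hm i) (hb i) (hb i) 1 0]
    simp [h0]
  induction n with
  | zero => simp
  | succ n ih =>
    have hS : AEMeasurable (fun ω ↦ ∑ i ∈ Finset.range n, ξ i ω) μ :=
      Finset.aemeasurable_fun_sum _ fun i _ ↦ hm i
    have I := integrable_pow_mul_pow hS (hm n) (abs_sum_range_le hb n) (hb n)
    have e (ω : Ω) : (∑ i ∈ Finset.range (n + 1), ξ i ω) ^ 4 =
        (∑ i ∈ Finset.range n, ξ i ω) ^ 4 * ξ n ω ^ 0 +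
          4 * ((∑ i ∈ Finset.range n, ξ i ω) ^ 3 * ξ n ω ^ 1) +
          6 * ((∑ i ∈ Finset.range n, ξ i ω) ^ 2 * ξ n ω ^ 2) +
          4 * ((∑ i ∈ Finset.range n, ξ i ω) ^ 1 * ξ n ω ^ 3) +
          (∑ i ∈ Finset.range n, ξ i ω) ^ 0 * ξ n ω ^ 4 := by
      rw [Finset.sum_range_succ]; ring
    simp_rw [e]
    have I1 := (I 3 1).const_mul 4
    have I2 := (I 2 2).const_mul 6
    have I3 := (I 1 3).const_mul 4
    rw [integral_add ((((I 4 0).fun_add I1).fun_add I2).fun_add I3) (I 0 4),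
      integral_add (((I 4 0).fun_add I1).fun_add I2) I3, integral_add ((I 4 0).fun_add I1) I2,
      integral_add (I 4 0) I1, integral_const_mul, integral_const_mul, integral_const_mul,
      integral_sum_range_pow_mul_pow hindep hm n 3 1,
      integral_sum_range_pow_mul_pow hindep hm n 2 2,
      integral_sum_range_pow_mul_pow hindep hm n 1 3]
    simp only [pow_zero, mul_one, one_mul, pow_one, h0, h1, mul_zero, zero_mul, add_zero]
    have hmul : (∫ ω, (∑ i ∈ Finset.range n, ξ i ω) ^ 2 ∂μ) * ∫ ω, ξ n ω ^ 2 ∂μ ≤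
        (n * c ^ 2) * c ^ 2 :=
      mul_le_mul (hsq n) (hpow n 2) (integral_nonneg fun ω ↦ sq_nonneg _) (by positivity)
    have h4 := hpow n 4
    have hc4 : 0 ≤ c ^ 4 := by positivity
    push_cast
    nlinarith [hmul, h4, hc4, ih]

end Moments

/-! ### Empirical frequencies of an i.i.d. sample -/

lemma toReal_pmf_le_one {V : Type*} (p : PMF V) (u : V) : (p u).toReal ≤ 1 :=
  ENNReal.toReal_le_of_le_ofReal zero_le_one (by simpa using p.coe_le_one u)

lemma integral_comp_of_hasLaw_pmf {V : Type*} [Fintype V] [MeasurableSpace V]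
    [MeasurableSingletonClass V] {Ω : Type*} [MeasurableSpace Ω] {μ : Measure Ω} {p : PMF V}
    {X : Ω → V} (hX : HasLaw X p.toMeasure μ) (f : V → ℝ) :
    ∫ ω, f (X ω) ∂μ = ∑ u, (p u).toReal * f u := by
  have := hX.integral_comp (f := f) (measurable_of_finite f).aestronglyMeasurable
  rw [Function.comp_def] at this
  rw [this, PMF.integral_eq_sum]
  simp

/-- The variance of `t u / p u` for a random node `u` with distribution `p`. As a quadratic form in
`t` it is the covariance of the rescaled relative errors of the empirical frequencies. -/
noncomputable def freqVariance {V : Type*} [Fintype V] (p : PMF V) (t : V → ℝ) : ℝ :=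
  ∑ u, t u ^ 2 / (p u).toReal - (∑ u, t u) ^ 2

lemma variance_div_pmf {V : Type*} [Fintype V] [MeasurableSpace V] [MeasurableSingletonClass V]
    {Ω : Type*} [MeasurableSpace Ω] {μ : Measure Ω} [IsProbabilityMeasure μ] {p : PMF V}
    (hp : ∀ u, 0 < (p u).toReal) {X : Ω → V} (hX : HasLaw X p.toMeasure μ)
    (t : V → ℝ) : Var[fun ω ↦ t (X ω) / (p (X ω)).toReal; μ] = freqVariance p t := by
  set f : V → ℝ := fun v ↦ t v / (p v).toReal with hf
  have hm : AEMeasurable (fun ω ↦ f (X ω)) μ :=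
    (measurable_of_finite f).comp_aemeasurable hX.aemeasurable
  have hL : MemLp (fun ω ↦ f (X ω)) 2 μ :=
    MemLp.of_bound hm.aestronglyMeasurable (∑ v, |f v|) (ae_of_all _ fun ω ↦
      Finset.single_le_sum (f := fun v ↦ |f v|) (fun _ _ ↦ abs_nonneg _) (Finset.mem_univ (X ω)))
  rw [variance_eq_sub hL]
  simp only [Pi.pow_apply]
  rw [integral_comp_of_hasLaw_pmf hX fun v ↦ f v ^ 2, integral_comp_of_hasLaw_pmf hX f,
    freqVariance]
  congr 1
  · refine Finset.sum_congr rfl fun u _ ↦ ?_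
    have := hp u
    simp only [hf]
    field_simp
  · congr 1
    refine Finset.sum_congr rfl fun u _ ↦ ?_
    have := hp u
    simp only [hf]
    field_simp

section Frequencies

variable {V : Type*} [DecidableEq V]

/-- The relative error of the empirical frequency of `u` among `z 0, …, z (n - 1)`, as an estimate
of `p u`. For `n = 0` its value is `-1`, the same as for a node that does not occur. -/
noncomputable def freqError (p : PMF V) (z : ℕ → V) (n : ℕ) (u : V) : ℝ :=
  occurrences z n u / (n * (p u).toReal) - 1

lemma freqError_ge (p : PMF V) (z : ℕ → V) (n : ℕ) (u : V) : -1 ≤ freqError p z n u := by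
  have : 0 ≤ occurrences z n u / (n * (p u).toReal) := by positivity
  unfold freqError
  linarith

lemma abs_freqError_le {p : PMF V} (z : ℕ → V) (n : ℕ) {u : V} (hp : 0 < (p u).toReal) :
    |freqError p z n u| ≤ 1 / (p u).toReal := by
  have h1 : 1 ≤ 1 / (p u).toReal := (one_le_div hp).2 (toReal_pmf_le_one p u)
  have h2 : occurrences z n u / (n * (p u).toReal) ≤ 1 / (p u).toReal := by
    rw [← div_div]
    gcongr
    exact div_le_one_of_le₀ (by exact_mod_cast occurrences_le z n u) (by positivity)
  have h3 := freqError_ge p z n u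
  rw [abs_le]
  unfold freqError at *
  constructor <;> linarith

lemma freqError_of_occurrences_eq_zero (p : PMF V) {z : ℕ → V} {n : ℕ} {u : V}
    (h : occurrences z n u = 0) : freqError p z n u = -1 := by
  simp [freqError, h]

lemma freqError_eq_sum {p : PMF V} (z : ℕ → V) {n : ℕ} (hn : n ≠ 0) {u : V}
    (hp : 0 < (p u).toReal) :
    freqError p z n u = (n * (p u).toReal)⁻¹ *
      ∑ i ∈ Finset.range n, ((if z i = u then 1 else 0) - (p u).toReal) := by
  have : (n : ℝ) ≠ 0 := by exact_mod_cast hn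
  rw [Finset.sum_sub_distrib]
  simp only [freqError, occurrences, Nat.cast_sum, Nat.cast_ite, Nat.cast_one, Nat.cast_zero,
    Finset.sum_const, Finset.card_range, nsmul_eq_mul]
  field_simp

/-- The second-order remainder of the logarithm, for an argument that may come as close to `0` as
`1 / N`. -/
lemma abs_log_one_add_sub_le {x N : ℝ} (hN : 1 ≤ N) (hx : 1 / N ≤ 1 + x) :
    |Real.log (1 + x) - x| ≤ (2 + 4 * Real.log N) * x ^ 2 := by
  have hN0 : 0 < N := by linarith
  have hpos : 0 < 1 + x := lt_of_lt_of_le (by positivity) hx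
  have hlogN : 0 ≤ Real.log N := Real.log_nonneg hN
  have hup : Real.log (1 + x) ≤ x := by
    have := Real.log_le_sub_one_of_pos hpos
    linarith
  rw [abs_of_nonpos (by linarith)]
  by_cases h : -(1 / 2) ≤ x
  · have h1 : 1 - (1 + x)⁻¹ ≤ Real.log (1 + x) := Real.one_sub_inv_le_log_of_pos hpos
    have h2 : x - (1 - (1 + x)⁻¹) = x ^ 2 * (1 + x)⁻¹ := by field_simp; ring
    have h3 : (1 + x)⁻¹ ≤ 2 := by
      rw [inv_le_comm₀ hpos two_pos]; linarith
    nlinarith [mul_le_mul_of_nonneg_left h3 (sq_nonneg x), mul_nonneg hlogN (sq_nonneg x)]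
  · have h1 : -Real.log N ≤ Real.log (1 + x) := by
      rw [← Real.log_inv, ← one_div]
      exact Real.log_le_log (by positivity) hx
    have h2 : 1 / 4 ≤ x ^ 2 := by nlinarith
    nlinarith [mul_le_mul_of_nonneg_left h2 hlogN]

lemma abs_log_one_add_freqError_sub_le {p : PMF V} {z : ℕ → V} {n N : ℕ} {u : V}
    (hp : 0 < (p u).toReal) (hz : 0 < occurrences z n u) (hN : n ≤ N) :
    |Real.log (1 + freqError p z n u) - freqError p z n u| ≤
      (2 + 4 * Real.log N) * freqError p z n u ^ 2 := by
  have hn : 0 < n := hz.trans_le (occurrences_le z n u)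
  have hn' : (0 : ℝ) < n := by exact_mod_cast hn
  have hN' : (n : ℝ) ≤ N := by exact_mod_cast hN
  have hocc : (1 : ℝ) ≤ occurrences z n u := by exact_mod_cast hz
  refine abs_log_one_add_sub_le (by exact_mod_cast hn.trans_le hN) ?_
  rw [freqError, add_sub_cancel]
  have h1 : n * (p u).toReal ≤ N := by
    nlinarith [mul_le_mul_of_nonneg_left (toReal_pmf_le_one p u) hn'.le]
  exact div_le_div₀ (by positivity) hocc (by positivity) h1

/-- Pairing the vector of relative errors with `t` gives a centred sum of the i.i.d. variables
`t (Z i) / p (Z i)`. -/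
lemma inner_sqrt_smul_freqError [Fintype V] {p : PMF V} (hp : ∀ u, 0 < (p u).toReal)
    (z : ℕ → V) {n : ℕ} (hn : n ≠ 0) (t : EuclideanSpace ℝ V) :
    inner ℝ (√(n : ℝ) • WithLp.toLp 2 (freqError p z n) : EuclideanSpace ℝ V) t =
      (√(n : ℝ))⁻¹ * (∑ i ∈ Finset.range n, t (z i) / (p (z i)).toReal - n * ∑ u, t u) := by
  have hn' : (0 : ℝ) < n := by positivity
  have hs : (√(n : ℝ))⁻¹ * n = √n := by
    rw [inv_mul_eq_div, Real.div_sqrt]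
  rw [sum_range_eq_sum_occurrences z n fun u ↦ t u / (p u).toReal, Finset.mul_sum,
    ← Finset.sum_sub_distrib, inner_smul_left, PiLp.inner_apply]
  rw [← hs, Finset.mul_sum, Finset.mul_sum]
  refine Finset.sum_congr rfl fun u _ ↦ ?_
  have := hp u
  simp [freqError]
  field_simp
  rw [Real.sq_sqrt hn'.le]

variable [Fintype V] [MeasurableSpace V] [MeasurableSingletonClass V]
  {Ω : Type*} [MeasurableSpace Ω] {μ : Measure Ω} {p : PMF V} {Z : ℕ → Ω → V}

lemma aemeasurable_freqError (hZ : ∀ i, AEMeasurable (Z i) μ) (n : ℕ) (u : V) :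
    AEMeasurable (fun ω ↦ freqError p (fun i ↦ Z i ω) n u) μ := by
  unfold freqError occurrences
  have h (i : ℕ) : AEMeasurable (fun ω ↦ ((if Z i ω = u then 1 else 0 : ℕ) : ℝ)) μ :=
    (measurable_of_finite fun v : V ↦ ((if v = u then 1 else 0 : ℕ) : ℝ)).comp_aemeasurable (hZ i)
  have h' := Finset.aemeasurable_fun_sum (Finset.range n) fun i _ ↦ h i
  simp_rw [Nat.cast_sum]
  fun_prop

lemma aemeasurable_sqrt_smul_freqError (hZ : ∀ i, AEMeasurable (Z i) μ) (n : ℕ) :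
    AEMeasurable (fun ω ↦ (√(n : ℝ) • WithLp.toLp 2 (freqError p (fun i ↦ Z i ω) n) :
      EuclideanSpace ℝ V)) μ := by
  have h : AEMeasurable (fun ω ↦ freqError p (fun i ↦ Z i ω) n) μ :=
    aemeasurable_pi_iff.2 fun u ↦ aemeasurable_freqError hZ n u
  fun_prop

/-- The centred indicators of `Z i = u` satisfy the hypotheses of the moment estimates. -/
lemma centred_indicator_properties (hZ : ∀ i, HasLaw (Z i) p.toMeasure μ) (hindep : iIndepFun Z μ)
    (u : V) :
    iIndepFun (fun i ω ↦ (if Z i ω = u then (1 : ℝ) else 0) - (p u).toReal) μ ∧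
    (∀ i, AEMeasurable (fun ω ↦ (if Z i ω = u then (1 : ℝ) else 0) - (p u).toReal) μ) ∧
    (∀ i ω, |(if Z i ω = u then (1 : ℝ) else 0) - (p u).toReal| ≤ 1) ∧
    (∀ i, ∫ ω, ((if Z i ω = u then (1 : ℝ) else 0) - (p u).toReal) ∂μ = 0) ∧
    ∀ i, ∫ ω, ((if Z i ω = u then (1 : ℝ) else 0) - (p u).toReal) ^ 2 ∂μ =
      (p u).toReal * (1 - (p u).toReal) := by
  set f : V → ℝ := fun v ↦ (if v = u then (1 : ℝ) else 0) - (p u).toReal with hf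
  have hfm : Measurable f := measurable_of_finite f
  have hsum : ∑ v, (p v).toReal = 1 := by
    have h := p.tsum_coe
    rw [tsum_fintype] at h
    rw [← ENNReal.toReal_sum fun v _ ↦ p.apply_ne_top v, h, ENNReal.toReal_one]
  have h0 : 0 ≤ (p u).toReal := ENNReal.toReal_nonneg
  have h1 := toReal_pmf_le_one p u
  refine ⟨hindep.comp (fun _ ↦ f) fun _ ↦ hfm,
    fun i ↦ hfm.comp_aemeasurable (hZ i).aemeasurable, fun i ω ↦ ?_, fun i ↦ ?_, fun i ↦ ?_⟩
  · rw [abs_le]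
    split_ifs <;> constructor <;> linarith
  · rw [integral_comp_of_hasLaw_pmf (hZ i) f]
    simp [hf, mul_sub, Finset.sum_sub_distrib, ← Finset.sum_mul, hsum]
  · rw [integral_comp_of_hasLaw_pmf (hZ i) fun v ↦ f v ^ 2]
    have e (v : V) : (p v).toReal * f v ^ 2 =
        (if v = u then (p v).toReal * (1 - 2 * (p u).toReal) else 0) +
          (p v).toReal * (p u).toReal ^ 2 := by
      simp only [hf]
      split_ifs <;> ring
    simp_rw [e]
    rw [Finset.sum_add_distrib, ← Finset.sum_mul, hsum]
    simp
    ring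

variable [IsProbabilityMeasure μ]

lemma integrable_freqError_pow (hZ : ∀ i, HasLaw (Z i) p.toMeasure μ) (n m : ℕ) {u : V}
    (hp : 0 < (p u).toReal) :
    Integrable (fun ω ↦ freqError p (fun i ↦ Z i ω) n u ^ m) μ := by
  have h := aemeasurable_freqError (p := p) (fun i ↦ (hZ i).aemeasurable) n u
  simpa using integrable_pow_mul_pow h h (fun ω ↦ abs_freqError_le _ n hp)
    (fun ω ↦ abs_freqError_le _ n hp) m 0

lemma integral_freqError (hZ : ∀ i, HasLaw (Z i) p.toMeasure μ) (hindep : iIndepFun Z μ) {n : ℕ}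
    (hn : n ≠ 0) {u : V} (hp : 0 < (p u).toReal) :
    ∫ ω, freqError p (fun i ↦ Z i ω) n u ∂μ = 0 := by
  obtain ⟨_, hm, hb, h0, _⟩ := centred_indicator_properties hZ hindep u
  simp_rw [freqError_eq_sum _ hn hp]
  rw [integral_const_mul, integral_finsetSum _ fun i _ ↦
    by simpa using integrable_pow_mul_pow (hm i) (hm i) (hb i) (hb i) 1 0]
  simp [h0]

lemma integral_freqError_sq (hZ : ∀ i, HasLaw (Z i) p.toMeasure μ) (hindep : iIndepFun Z μ) {n : ℕ}
    (hn : n ≠ 0) {u : V} (hp : 0 < (p u).toReal) :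
    ∫ ω, freqError p (fun i ↦ Z i ω) n u ^ 2 ∂μ = (1 / (p u).toReal - 1) / n := by
  obtain ⟨hi, hm, hb, h0, h2⟩ := centred_indicator_properties hZ hindep u
  have hn' : (n : ℝ) ≠ 0 := by exact_mod_cast hn
  simp_rw [freqError_eq_sum _ hn hp, mul_pow]
  rw [integral_const_mul, integral_sum_range_sq hi hm hb h0]
  simp only [h2, Finset.sum_const, Finset.card_range, nsmul_eq_mul]
  field_simp

lemma integral_freqError_pow_four_le (hZ : ∀ i, HasLaw (Z i) p.toMeasure μ)
    (hindep : iIndepFun Z μ) {n : ℕ} (hn : n ≠ 0) {u : V} (hp : 0 < (p u).toReal) :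
    ∫ ω, freqError p (fun i ↦ Z i ω) n u ^ 4 ∂μ ≤ 3 / (p u).toReal ^ 4 / n ^ 2 := by
  obtain ⟨hi, hm, hb, h0, _⟩ := centred_indicator_properties hZ hindep u
  have hn' : (n : ℝ) ≠ 0 := by exact_mod_cast hn
  simp_rw [freqError_eq_sum _ hn hp, mul_pow]
  rw [integral_const_mul]
  refine (mul_le_mul_of_nonneg_left (integral_sum_range_pow_four_le hi hm hb h0 n)
    (by positivity)).trans (le_of_eq ?_)
  field_simp

/-- The central limit theorem for the vector of empirical frequencies, in terms of characteristic
functions. -/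
lemma tendsto_charFun_freqError (hp : ∀ u, 0 < (p u).toReal)
    (hZ : ∀ i, HasLaw (Z i) p.toMeasure μ) (hindep : iIndepFun Z μ) (t : EuclideanSpace ℝ V) :
    Tendsto (fun n : ℕ ↦ charFun (μ.map fun ω ↦
        (√(n : ℝ) • WithLp.toLp 2 (freqError p (fun i ↦ Z i ω) n) : EuclideanSpace ℝ V)) t)
      atTop (𝓝 (Complex.exp (-(freqVariance p t : ℂ) / 2))) := by
  set f : V → ℝ := fun v ↦ t v / (p v).toReal with hf
  have hfm : Measurable f := measurable_of_finite f
  have hm i : AEMeasurable (fun ω ↦ f (Z i ω)) μ := hfm.comp_aemeasurable (hZ i).aemeasurable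
  have hmean : ∫ ω, t (Z 0 ω) / (p (Z 0 ω)).toReal ∂μ = ∑ u, t u := by
    rw [integral_comp_of_hasLaw_pmf (hZ 0) f]
    refine Finset.sum_congr rfl fun u _ ↦ ?_
    have := hp u
    simp only [hf]
    field_simp
  have hvar : Var[fun ω ↦ f (Z 0 ω); μ] = freqVariance p t := variance_div_pmf hp (hZ 0) t
  have hL : MemLp (fun ω ↦ f (Z 0 ω)) 2 μ :=
    MemLp.of_bound (hm 0).aestronglyMeasurable (∑ v, |f v|) (ae_of_all _ fun ω ↦
      Finset.single_le_sum (f := fun v ↦ |f v|) (fun _ _ ↦ abs_nonneg _) (Finset.mem_univ (Z 0 ω)))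
  have hclt := tendstoInDistribution_inv_sqrt_mul_sum_sub (X := fun i ω ↦ f (Z i ω)) (P := μ)
    (Y := id) (P' := gaussianReal 0 Var[fun ω ↦ f (Z 0 ω); μ].toNNReal) HasLaw.id hL
    (hindep.comp (fun _ ↦ f) fun _ ↦ hfm)
    (fun i ↦ (IdentDistrib.mk (hZ i).aemeasurable (hZ 0).aemeasurable
      ((hZ i).map_eq.trans (hZ 0).map_eq.symm)).comp hfm)
  have h1 := ProbabilityMeasure.tendsto_iff_tendsto_charFun.1 hclt.tendsto 1
  simp only [ProbabilityMeasure.coe_mk, Measure.map_id, charFun_gaussianReal, hvar] at h1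
  have hnn : 0 ≤ freqVariance p t := hvar ▸ variance_nonneg _ _
  rw [Real.coe_toNNReal _ hnn] at h1
  refine (Tendsto.congr' ?_ h1).trans_eq ?_
  · filter_upwards [eventually_ne_atTop 0] with n hn
    rw [charFun_apply, charFun_apply,
      integral_map (hclt.forall_aemeasurable n) (by fun_prop),
      integral_map (aemeasurable_sqrt_smul_freqError (fun i ↦ (hZ i).aemeasurable) n)
        (by fun_prop)]
    refine integral_congr_ae (ae_of_all _ fun ω ↦ ?_)
    simp only [inner_sqrt_smul_freqError hp _ hn t, hf, hmean]
    simp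
  · congr 2
    push_cast
    ring

end Frequencies

/-! ### Linearization of the empirical optimum -/

/-- The constant in `sq_sub_linearError_le`; it grows like `(log T) ^ 2`. -/
noncomputable def remainderConst {V : Type*} (pd pn : PMF V) (k T : ℕ) (u : V) : ℝ :=
  2 * (2 + 4 * Real.log (k * T)) ^ 2 + (1 / (pd u).toReal + 1 / (pn u).toReal) ^ 2

lemma tendsto_remainderConst_div {V : Type*} (pd pn : PMF V) {k : ℕ} (hk : 1 ≤ k) (u : V) :
    Tendsto (fun T : ℕ ↦ remainderConst pd pn k T u / T) atTop (𝓝 0) := by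
  have hk' : (0 : ℝ) < k := by exact_mod_cast hk
  have hTop : Tendsto (fun T : ℕ ↦ (k : ℝ) * T) atTop atTop :=
    tendsto_natCast_atTop_atTop.const_mul_atTop hk'
  have hlog (n : ℕ) : Tendsto (fun T : ℕ ↦ Real.log (k * T) ^ n / (k * T)) atTop (𝓝 0) := by
    have := (Real.tendsto_pow_log_div_mul_add_atTop 1 0 n one_ne_zero).comp hTop
    simpa [Function.comp_def] using this
  -- The expansion `2 * (2 + 4 * l) ^ 2 = 8 + 32 * l + 32 * l ^ 2` with `l = log (k * T)`.
  set C := 8 + (1 / (pd u).toReal + 1 / (pn u).toReal) ^ 2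
  have h := (((hlog 2).const_mul (32 * k : ℝ)).add ((hlog 1).const_mul (32 * k : ℝ))).add
    ((hlog 0).const_mul (C * k))
  simp only [mul_zero, add_zero] at h
  refine h.congr' ?_
  filter_upwards [eventually_gt_atTop 0] with T hT
  have hT' : (0 : ℝ) < T := by exact_mod_cast hT
  simp only [remainderConst, C]
  field_simp
  ring

section Linearization

variable {V : Type*} [DecidableEq V]

/-- The linear part of the rescaled error `√T (θ_T - θ*)`: the difference of the relative errors of
the positive and of the negative empirical frequencies. -/
noncomputable def linearError (pd pn : PMF V) (k T : ℕ) (x y : ℕ → V) : EuclideanSpace ℝ V :=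
  √(T : ℝ) • WithLp.toLp 2 (freqError pd x T - freqError pn y (k * T))

lemma linearError_apply (pd pn : PMF V) (k T : ℕ) (x y : ℕ → V) (u : V) :
    linearError pd pn k T x y u = √(T : ℝ) * (freqError pd x T u - freqError pn y (k * T) u) := by
  simp [linearError]

/-- The sum of the fourth powers of all relative errors of the empirical frequencies. It bounds both
the squared remainder of the linearization and the indicator of a node missing in the samples. -/
noncomputable def quarticError [Fintype V] (pd pn : PMF V) (k T : ℕ) (x y : ℕ → V) : ℝ :=
  ∑ u, (freqError pd x T u ^ 4 + freqError pn y (k * T) u ^ 4)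

lemma le_quarticError [Fintype V] (pd pn : PMF V) (k T : ℕ) (x y : ℕ → V) (u : V) :
    freqError pd x T u ^ 4 + freqError pn y (k * T) u ^ 4 ≤ quarticError pd pn k T x y :=
  Finset.single_le_sum (f := fun u ↦ freqError pd x T u ^ 4 + freqError pn y (k * T) u ^ 4)
    (fun _ _ ↦ by positivity) (Finset.mem_univ u)

lemma quarticError_nonneg [Fintype V] (pd pn : PMF V) (k T : ℕ) (x y : ℕ → V) :
    0 ≤ quarticError pd pn k T x y :=
  Finset.sum_nonneg fun _ _ ↦ by positivity

/-- A missing node has relative error `-1`. -/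
lemma one_le_quarticError [Fintype V] (pd pn : PMF V) {k T : ℕ} {x y : ℕ → V}
    (h : ¬ ∀ u, 0 < occurrences x T u ∧ 0 < occurrences y (k * T) u) :
    1 ≤ quarticError pd pn k T x y := by
  push Not at h
  obtain ⟨u, hu⟩ := h
  refine le_trans ?_ (le_quarticError pd pn k T x y u)
  by_cases h0 : 0 < occurrences x T u
  · rw [freqError_of_occurrences_eq_zero pn (Nat.le_zero.1 (hu h0))]
    have : 0 ≤ freqError pd x T u ^ 4 := by positivity
    linarith
  · rw [freqError_of_occurrences_eq_zero pd (Nat.eq_zero_of_not_pos h0)]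
    have : 0 ≤ freqError pn y (k * T) u ^ 4 := by positivity
    linarith

lemma log_div_sub_log_div_eq {pd pn : PMF V} {k T : ℕ} (hk : 1 ≤ k) {x y : ℕ → V} {u : V}
    (hpd : 0 < (pd u).toReal) (hpn : 0 < (pn u).toReal) (hx : 0 < occurrences x T u)
    (hy : 0 < occurrences y (k * T) u) :
    Real.log (occurrences x T u / occurrences y (k * T) u) -
        Real.log ((pd u).toReal / (k * (pn u).toReal)) =
      Real.log (1 + freqError pd x T u) - Real.log (1 + freqError pn y (k * T) u) := by
  have hT : (0 : ℝ) < T := by exact_mod_cast hx.trans_le (occurrences_le x T u)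
  have hk' : (0 : ℝ) < k := by exact_mod_cast hk
  have hx' : (0 : ℝ) < occurrences x T u := by exact_mod_cast hx
  have hy' : (0 : ℝ) < occurrences y (k * T) u := by exact_mod_cast hy
  simp only [freqError, add_sub_cancel, Nat.cast_mul]
  rw [← Real.log_div (by positivity) (by positivity),
    ← Real.log_div (by positivity) (by positivity)]
  congr 1
  field_simp

/-- If all nodes occur, `d` is a coordinate of the rescaled error of the empirical optimum, and
otherwise it is set to `0`; in both cases it is close to the linear part of the error. -/
lemma sq_sub_linearError_le [Fintype V] {pd pn : PMF V} (hpd : ∀ u, 0 < (pd u).toReal)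
    (hpn : ∀ u, 0 < (pn u).toReal) {k T : ℕ} (hk : 1 ≤ k) {x y : ℕ → V} {u : V} {d : ℝ}
    (hd : (∀ u, 0 < occurrences x T u ∧ 0 < occurrences y (k * T) u) →
      d = √(T : ℝ) * (Real.log (occurrences x T u / occurrences y (k * T) u) -
        Real.log ((pd u).toReal / (k * (pn u).toReal))))
    (hd' : (¬ ∀ u, 0 < occurrences x T u ∧ 0 < occurrences y (k * T) u) → d = 0) :
    (d - linearError pd pn k T x y u) ^ 2 ≤
      T * remainderConst pd pn k T u * quarticError pd pn k T x y := by
  have hQ := le_quarticError pd pn k T x y u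
  have hQ0 := quarticError_nonneg pd pn k T x y
  have hT : (0 : ℝ) ≤ T := by positivity
  rw [linearError_apply]
  unfold remainderConst
  set L := 2 + 4 * Real.log (k * T) with hL
  set Q := quarticError pd pn k T x y with hQdef
  set a := freqError pd x T u with ha
  set b := freqError pn y (k * T) u with hb
  by_cases h : ∀ u, 0 < occurrences x T u ∧ 0 < occurrences y (k * T) u
  · have h1 := abs_log_one_add_freqError_sub_le (p := pd) (hpd u) (h u).1
      (Nat.le_mul_of_pos_left T hk)
    have h2 := abs_log_one_add_freqError_sub_le (p := pn) (hpn u) (h u).2 le_rfl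
    rw [Nat.cast_mul] at h1 h2
    rw [hd h, log_div_sub_log_div_eq hk (hpd u) (hpn u) (h u).1 (h u).2]
    rw [← ha] at h1 ⊢
    rw [← hb] at h2 ⊢
    set r := Real.log (1 + a) - a
    set s := Real.log (1 + b) - b
    have e : (√(T : ℝ) * (Real.log (1 + a) - Real.log (1 + b)) - √(T : ℝ) * (a - b)) ^ 2 =
        T * (r - s) ^ 2 := by
      rw [← mul_sub, mul_pow, Real.sq_sqrt hT]
      simp only [r, s]
      ring
    rw [e, mul_assoc]
    refine mul_le_mul_of_nonneg_left ?_ hT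
    have hrs : |r - s| ≤ L * (a ^ 2 + b ^ 2) := by
      refine (abs_sub r s).trans ?_
      linarith
    have h3 : (r - s) ^ 2 ≤ (L * (a ^ 2 + b ^ 2)) ^ 2 := by
      rw [← sq_abs]
      gcongr
    have h4 : (a ^ 2 + b ^ 2) ^ 2 ≤ 2 * Q := by
      nlinarith [sq_nonneg (a ^ 2 - b ^ 2)]
    have h5 : L ^ 2 * (a ^ 2 + b ^ 2) ^ 2 ≤ L ^ 2 * (2 * Q) :=
      mul_le_mul_of_nonneg_left h4 (sq_nonneg L)
    have h6 : 0 ≤ (1 / (pd u).toReal + 1 / (pn u).toReal) ^ 2 * Q := by positivity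
    calc (r - s) ^ 2 ≤ L ^ 2 * (a ^ 2 + b ^ 2) ^ 2 := by rw [← mul_pow]; exact h3
      _ ≤ L ^ 2 * (2 * Q) := h5
      _ ≤ _ := by linarith
  · have hQ1 : 1 ≤ Q := one_le_quarticError pd pn h
    have h1 : |a - b| ≤ 1 / (pd u).toReal + 1 / (pn u).toReal :=
      (abs_sub a b).trans (add_le_add (abs_freqError_le x T (hpd u))
        (abs_freqError_le y (k * T) (hpn u)))
    have e : (0 - √(T : ℝ) * (a - b)) ^ 2 = T * (a - b) ^ 2 := by
      rw [zero_sub, neg_sq, mul_pow, Real.sq_sqrt hT]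
    rw [hd' h, e, mul_assoc]
    refine mul_le_mul_of_nonneg_left ?_ hT
    have h2 : (a - b) ^ 2 ≤ (1 / (pd u).toReal + 1 / (pn u).toReal) ^ 2 := by
      rw [← sq_abs]
      gcongr
    have h3 : 0 ≤ 2 * L ^ 2 := by positivity
    nlinarith [mul_le_mul_of_nonneg_left hQ1 (add_nonneg h3
      (sq_nonneg (1 / (pd u).toReal + 1 / (pn u).toReal)))]

end Linearization

/-! ### The limit law of the linear part -/

section LinearLimit

lemma asymptoticCovariance_apply {V : Type*} [Fintype V] [DecidableEq V] {pd pn : PMF V}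
    (hpd : ∀ u, 0 < (pd u).toReal) (hpn : ∀ u, 0 < (pn u).toReal) {k : ℕ} (hk : 1 ≤ k) (u w : V) :
    asymptoticCovariance pd pn k u w =
      (if u = w then 1 / (pd u).toReal + 1 / (k * (pn u).toReal) else 0) - (1 + 1 / (k : ℝ)) := by
  have hk' : (0 : ℝ) < k := by exact_mod_cast hk
  have hw : ∀ v, weight pd pn k v ≠ 0 := fun v ↦ by
    have := hpd v
    have := hpn v
    unfold weight
    positivity
  have hinv : (Matrix.diagonal (weight pd pn k))⁻¹ =
      Matrix.diagonal fun v ↦ (weight pd pn k v)⁻¹ := by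
    refine Matrix.inv_eq_left_inv ?_
    rw [Matrix.diagonal_mul_diagonal, ← Matrix.diagonal_one]
    congr 1
    ext v
    exact inv_mul_cancel₀ (hw v)
  simp only [asymptoticCovariance, hinv, Matrix.sub_apply, Matrix.diagonal_apply, Matrix.smul_apply,
    Matrix.of_apply, smul_eq_mul, mul_one]
  congr 1
  split_ifs with h
  · have := hpd u
    have := hpn u
    unfold weight
    field_simp
    ring
  · rfl

lemma dotProduct_asymptoticCovariance_mulVec {V : Type*} [Fintype V] [DecidableEq V] {pd pn : PMF V}
    (hpd : ∀ u, 0 < (pd u).toReal) (hpn : ∀ u, 0 < (pn u).toReal) {k : ℕ} (hk : 1 ≤ k) (t : V → ℝ) :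
    t ⬝ᵥ (asymptoticCovariance pd pn k).mulVec t = freqVariance pd t + freqVariance pn t / k := by
  have hk' : (0 : ℝ) < k := by exact_mod_cast hk
  simp only [dotProduct, Matrix.mulVec, asymptoticCovariance_apply hpd hpn hk, sub_mul, ite_mul,
    zero_mul, Finset.sum_sub_distrib, Finset.sum_ite_eq, Finset.mem_univ, if_true, mul_sub,
    freqVariance]
  have e (u : V) : t u * ((1 / (pd u).toReal + 1 / (k * (pn u).toReal)) * t u) =
      t u ^ 2 / (pd u).toReal + t u ^ 2 / (pn u).toReal / k := by
    have := hpd u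
    have := hpn u
    field_simp
  simp_rw [e]
  rw [Finset.sum_add_distrib, ← Finset.sum_div, ← Finset.mul_sum, ← Finset.sum_mul]
  ring

lemma freqError_congr {V : Type*} [DecidableEq V] (p : PMF V) {z z' : ℕ → V} {n : ℕ}
    (h : ∀ i < n, z i = z' i) : freqError p z n = freqError p z' n := by
  have : occurrences z n = occurrences z' n := by
    ext u
    exact Finset.sum_congr rfl fun i hi ↦ by rw [h i (Finset.mem_range.1 hi)]
  unfold freqError
  rw [this]

lemma iIndepFun_inl {V Ω : Type*} [MeasurableSpace V] [MeasurableSpace Ω] {μ : Measure Ω}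
    {X Y : ℕ → Ω → V} (hindep : iIndepFun (fun i : ℕ ⊕ ℕ => Sum.elim X Y i) μ) : iIndepFun X μ :=
  iIndepFun.precomp (f := fun i ↦ Sum.elim X Y i) Sum.inl_injective hindep

lemma iIndepFun_inr {V Ω : Type*} [MeasurableSpace V] [MeasurableSpace Ω] {μ : Measure Ω}
    {X Y : ℕ → Ω → V} (hindep : iIndepFun (fun i : ℕ ⊕ ℕ => Sum.elim X Y i) μ) : iIndepFun Y μ :=
  iIndepFun.precomp (f := fun i ↦ Sum.elim X Y i) Sum.inr_injective hindep

variable {V : Type*} [Fintype V] [DecidableEq V] [MeasurableSpace V] [MeasurableSingletonClass V]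
  {Ω : Type*} [MeasurableSpace Ω] {μ : Measure Ω} {pd pn : PMF V} {k : ℕ} {X Y : ℕ → Ω → V}

/-- The frequency errors of the two samples are functions of disjoint finite subfamilies of the
joint family, which are independent. -/
lemma indepFun_freqError (hX : ∀ i, AEMeasurable (X i) μ) (hY : ∀ i, AEMeasurable (Y i) μ)
    (hindep : iIndepFun (fun i : ℕ ⊕ ℕ => Sum.elim X Y i) μ) (n m : ℕ) :
    IndepFun (fun ω ↦ freqError pd (fun i ↦ X i ω) n) (fun ω ↦ freqError pn (fun i ↦ Y i ω) m)
      μ := by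
  have v₀ : V := pd.support_nonempty.some
  -- Off the observed indices the sequences are continued by an arbitrary node, which does not
  -- change the first `n` or `m` samples.
  let S : Finset (ℕ ⊕ ℕ) := (Finset.range n).map Function.Embedding.inl
  let S' : Finset (ℕ ⊕ ℕ) := (Finset.range m).map Function.Embedding.inr
  have hdisj : Disjoint S S' := by
    rw [Finset.disjoint_left]
    intro i hi hi'
    simp only [S, S', Finset.mem_map] at hi hi'
    obtain ⟨a, _, rfl⟩ := hi
    obtain ⟨b, _, hb⟩ := hi'
    exact Sum.inr_ne_inl hb
  have hmeas : ∀ i : ℕ ⊕ ℕ, AEMeasurable (Sum.elim X Y i) μ := by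
    rintro (i | i)
    exacts [hX i, hY i]
  have h := hindep.indepFun_finset₀ S S' hdisj hmeas
  let φ : (S → V) → V → ℝ := fun v ↦
    freqError pd (fun i ↦ if hi : Sum.inl i ∈ S then v ⟨Sum.inl i, hi⟩ else v₀) n
  let ψ : (S' → V) → V → ℝ := fun v ↦
    freqError pn (fun i ↦ if hi : Sum.inr i ∈ S' then v ⟨Sum.inr i, hi⟩ else v₀) m
  have h' := h.comp (φ := φ) (ψ := ψ) (measurable_of_finite φ) (measurable_of_finite ψ)
  convert h' using 1
  · ext1 ω
    refine freqError_congr pd fun i hi ↦ ?_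
    have : Sum.inl i ∈ S := by simpa [S] using hi
    simp [this]
  · ext1 ω
    refine freqError_congr pn fun i hi ↦ ?_
    have : Sum.inr i ∈ S' := by simpa [S'] using hi
    simp [this]

lemma aemeasurable_linearError (hX : ∀ i, AEMeasurable (X i) μ) (hY : ∀ i, AEMeasurable (Y i) μ)
    (T : ℕ) :
    AEMeasurable (fun ω ↦ linearError pd pn k T (fun i ↦ X i ω) (fun i ↦ Y i ω)) μ := by
  have h : AEMeasurable (fun ω ↦ freqError pd (fun i ↦ X i ω) T) μ :=
    aemeasurable_pi_iff.2 fun u ↦ aemeasurable_freqError hX T u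
  have h' : AEMeasurable (fun ω ↦ freqError pn (fun i ↦ Y i ω) (k * T)) μ :=
    aemeasurable_pi_iff.2 fun u ↦ aemeasurable_freqError hY (k * T) u
  unfold linearError
  fun_prop

variable [IsProbabilityMeasure μ]

lemma posSemidef_asymptoticCovariance (hpd : ∀ u, 0 < (pd u).toReal)
    (hpn : ∀ u, 0 < (pn u).toReal) (hk : 1 ≤ k) : (asymptoticCovariance pd pn k).PosSemidef := by
  have hnn (p : PMF V) (hp : ∀ u, 0 < (p u).toReal) (t : V → ℝ) : 0 ≤ freqVariance p t := by
    rw [← variance_div_pmf hp (X := id) (μ := p.toMeasure) HasLaw.id t]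
    exact variance_nonneg _ _
  refine Matrix.PosSemidef.of_dotProduct_mulVec_nonneg ?_ fun t ↦ ?_
  · ext u w
    rw [Matrix.conjTranspose_apply, star_trivial, asymptoticCovariance_apply hpd hpn hk,
      asymptoticCovariance_apply hpd hpn hk]
    by_cases h : u = w
    · rw [h]
    · rw [if_neg h, if_neg (Ne.symm h)]
  · rw [star_trivial, dotProduct_asymptoticCovariance_mulVec hpd hpn hk]
    have h1 := hnn pd hpd t
    have h2 := hnn pn hpn t
    positivity

/-- The central limit theorem for the linear part: its characteristic function is the product of
those of the positive and of the negative sample. -/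
lemma tendstoInDistribution_linearError (hpd : ∀ u, 0 < (pd u).toReal)
    (hpn : ∀ u, 0 < (pn u).toReal) (hk : 1 ≤ k) (hX : ∀ i, HasLaw (X i) pd.toMeasure μ)
    (hY : ∀ i, HasLaw (Y i) pn.toMeasure μ)
    (hindep : iIndepFun (fun i : ℕ ⊕ ℕ => Sum.elim X Y i) μ) :
    TendstoInDistribution
      (fun (T : ℕ) ω ↦ linearError pd pn k T (fun i ↦ X i ω) (fun i ↦ Y i ω)) atTop
      (fun z : EuclideanSpace ℝ V ↦ z) (fun _ ↦ μ)
      (multivariateGaussian 0 (asymptoticCovariance pd pn k)) where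
  forall_aemeasurable T := aemeasurable_linearError (fun i ↦ (hX i).aemeasurable)
    (fun i ↦ (hY i).aemeasurable) T
  tendsto := by
    have hk' : (0 : ℝ) < k := by exact_mod_cast hk
    refine ProbabilityMeasure.tendsto_iff_tendsto_charFun.2 fun t ↦ ?_
    simp only [ProbabilityMeasure.coe_mk, Measure.map_id']
    rw [charFun_multivariateGaussian (posSemidef_asymptoticCovariance hpd hpn hk),
      dotProduct_asymptoticCovariance_mulVec hpd hpn hk]
    -- The negative sample has size `k * T`, so that `√T = √(k * T) / √k` rescales its error.
    set c : ℝ := -(√(k : ℝ))⁻¹ with hc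
    have hkT : Tendsto (fun T : ℕ ↦ k * T) atTop atTop :=
      tendsto_id.const_mul_atTop' hk
    have h1 := tendsto_charFun_freqError hpd hX (iIndepFun_inl hindep) t
    have h2 := (tendsto_charFun_freqError hpn hY (iIndepFun_inr hindep) (c • t)).comp hkT
    have hv : freqVariance pn (c • t) = freqVariance pn t / k := by
      have hc2 : c ^ 2 = 1 / k := by
        rw [hc, neg_sq, inv_pow, Real.sq_sqrt hk'.le, one_div]
      simp only [freqVariance, Pi.smul_apply, smul_eq_mul, ← Finset.mul_sum, mul_pow, mul_div_assoc,
        hc2]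
      ring
    have h := h1.mul h2
    rw [← Complex.exp_add] at h
    refine (h.congr fun T ↦ ?_).trans_eq ?_
    · have hmX := aemeasurable_sqrt_smul_freqError (p := pd) (fun i ↦ (hX i).aemeasurable) T
      have hmY := aemeasurable_sqrt_smul_freqError (p := pn) (fun i ↦ (hY i).aemeasurable) (k * T)
      have hI : IndepFun
          (fun ω ↦ (√(T : ℝ) • WithLp.toLp 2 (freqError pd (fun i ↦ X i ω) T) :
            EuclideanSpace ℝ V))
          (fun ω ↦ c • (√((k * T : ℕ) : ℝ) • WithLp.toLp 2 (freqError pn (fun i ↦ Y i ω) (k * T)) :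
            EuclideanSpace ℝ V)) μ :=
        (indepFun_freqError (fun i ↦ (hX i).aemeasurable) (fun i ↦ (hY i).aemeasurable) hindep T
          (k * T)).comp
          (φ := fun v ↦ (√(T : ℝ) • WithLp.toLp 2 v : EuclideanSpace ℝ V))
          (ψ := fun v ↦ c • (√((k * T : ℕ) : ℝ) • WithLp.toLp 2 v : EuclideanSpace ℝ V))
          (by fun_prop) (by fun_prop)
      have hadd := hI.charFun_map_fun_add_eq_mul hmX (hmY.fun_const_smul c)
      have hsm := charFun_map_smul_comp hmY c t
      rw [Function.comp_apply, ← hsm, ← Pi.mul_apply, ← hadd]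
      congr 2
      ext ω u
      have : c * √((k * T : ℕ) : ℝ) = -√(T : ℝ) := by
        rw [Nat.cast_mul, Real.sqrt_mul hk'.le, hc]
        have := Real.sqrt_pos.2 hk'
        field_simp
      simp only [linearError, PiLp.add_apply, PiLp.smul_apply, Pi.sub_apply, smul_eq_mul]
      rw [← mul_assoc, this]
      ring
    · rw [WithLp.ofLp_smul, hv]
      congr 2
      simp
      ring

lemma integral_linearError_sq (hpd : ∀ u, 0 < (pd u).toReal)
    (hpn : ∀ u, 0 < (pn u).toReal) (hk : 1 ≤ k) (hX : ∀ i, HasLaw (X i) pd.toMeasure μ)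
    (hY : ∀ i, HasLaw (Y i) pn.toMeasure μ)
    (hindep : iIndepFun (fun i : ℕ ⊕ ℕ => Sum.elim X Y i) μ) {T : ℕ} (hT : T ≠ 0) (u : V) :
    ∫ ω, linearError pd pn k T (fun i ↦ X i ω) (fun i ↦ Y i ω) u ^ 2 ∂μ =
      1 / (pd u).toReal - 1 + 1 / (k * (pn u).toReal) - 1 / (k : ℝ) := by
  have hk' : (0 : ℝ) < k := by exact_mod_cast hk
  have hT' : (0 : ℝ) < T := by positivity
  have hkT : k * T ≠ 0 := by positivity
  have hmX := aemeasurable_freqError (p := pd) (fun i ↦ (hX i).aemeasurable) T u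
  have hmY := aemeasurable_freqError (p := pn) (fun i ↦ (hY i).aemeasurable) (k * T) u
  have hcross : ∫ ω, freqError pd (fun i ↦ X i ω) T u * freqError pn (fun i ↦ Y i ω) (k * T) u ∂μ
      = 0 := by
    have hev : Measurable fun v : V → ℝ ↦ v u := measurable_pi_apply u
    have hI := (indepFun_freqError (pd := pd) (pn := pn) (fun i ↦ (hX i).aemeasurable)
      (fun i ↦ (hY i).aemeasurable) hindep T (k * T)).comp (φ := fun v : V → ℝ ↦ v u)
      (ψ := fun v : V → ℝ ↦ v u) hev hev
    have := hI.integral_fun_mul_eq_mul_integral hmX.aestronglyMeasurable hmY.aestronglyMeasurable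
    simp only [Function.comp_apply] at this
    rw [this, integral_freqError hX (iIndepFun_inl hindep) hT (hpd u), zero_mul]
  have I (a b : ℕ) := integrable_pow_mul_pow hmX hmY (fun ω ↦ abs_freqError_le _ _ (hpd u))
    (fun ω ↦ abs_freqError_le _ _ (hpn u)) a b
  have e (ω : Ω) : linearError pd pn k T (fun i ↦ X i ω) (fun i ↦ Y i ω) u ^ 2 =
      T * (freqError pd (fun i ↦ X i ω) T u ^ 2 * freqError pn (fun i ↦ Y i ω) (k * T) u ^ 0 +
        -2 * (freqError pd (fun i ↦ X i ω) T u ^ 1 * freqError pn (fun i ↦ Y i ω) (k * T) u ^ 1) +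
        freqError pd (fun i ↦ X i ω) T u ^ 0 * freqError pn (fun i ↦ Y i ω) (k * T) u ^ 2) := by
    rw [linearError_apply, mul_pow, Real.sq_sqrt hT'.le]
    ring
  simp_rw [e]
  rw [integral_const_mul, integral_add ((I 2 0).fun_add ((I 1 1).const_mul (-2))) (I 0 2),
    integral_add (I 2 0) ((I 1 1).const_mul (-2)), integral_const_mul]
  simp only [pow_zero, mul_one, one_mul, pow_one]
  have := hpd u
  have := hpn u
  rw [hcross, integral_freqError_sq hX (iIndepFun_inl hindep) hT (hpd u),
    integral_freqError_sq hY (iIndepFun_inr hindep) hkT (hpn u), Nat.cast_mul]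
  field_simp
  ring

lemma integrable_quarticError (hpd : ∀ u, 0 < (pd u).toReal)
    (hpn : ∀ u, 0 < (pn u).toReal) (hX : ∀ i, HasLaw (X i) pd.toMeasure μ)
    (hY : ∀ i, HasLaw (Y i) pn.toMeasure μ) (T : ℕ) :
    Integrable (fun ω ↦ quarticError pd pn k T (fun i ↦ X i ω) (fun i ↦ Y i ω)) μ :=
  integrable_finsetSum _ fun u _ ↦
    (integrable_freqError_pow hX T 4 (hpd u)).add (integrable_freqError_pow hY (k * T) 4 (hpn u))

lemma integral_quarticError_le (hpd : ∀ u, 0 < (pd u).toReal)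
    (hpn : ∀ u, 0 < (pn u).toReal) (hk : 1 ≤ k) (hX : ∀ i, HasLaw (X i) pd.toMeasure μ)
    (hY : ∀ i, HasLaw (Y i) pn.toMeasure μ)
    (hindep : iIndepFun (fun i : ℕ ⊕ ℕ => Sum.elim X Y i) μ) {T : ℕ} (hT : T ≠ 0) :
    ∫ ω, quarticError pd pn k T (fun i ↦ X i ω) (fun i ↦ Y i ω) ∂μ ≤
      (∑ u, (3 / (pd u).toReal ^ 4 + 3 / (pn u).toReal ^ 4)) / T ^ 2 := by
  have hk' : (1 : ℝ) ≤ k := by exact_mod_cast hk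
  have hT' : (0 : ℝ) < T := by positivity
  have hkT : k * T ≠ 0 := by positivity
  unfold quarticError
  rw [integral_finsetSum _ fun u _ ↦ (integrable_freqError_pow hX T 4 (hpd u)).fun_add
    (integrable_freqError_pow hY (k * T) 4 (hpn u)), Finset.sum_div]
  refine Finset.sum_le_sum fun u _ ↦ ?_
  rw [integral_add (integrable_freqError_pow hX T 4 (hpd u))
    (integrable_freqError_pow hY (k * T) 4 (hpn u)), add_div]
  refine add_le_add (integral_freqError_pow_four_le hX (iIndepFun_inl hindep) hT (hpd u))
    ((integral_freqError_pow_four_le hY (iIndepFun_inr hindep) hkT (hpn u)).trans ?_)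
  have := hpn u
  gcongr
  exact_mod_cast Nat.le_mul_of_pos_left T hk

end LinearLimit

/-! ### Mean-square comparison -/

section MeanSquare

variable {Ω : Type*} [MeasurableSpace Ω] {μ : Measure Ω}

lemma sq_integral_mul_le {f g : Ω → ℝ} (hf : MemLp f 2 μ) (hg : MemLp g 2 μ) :
    (∫ ω, f ω * g ω ∂μ) ^ 2 ≤ (∫ ω, f ω ^ 2 ∂μ) * ∫ ω, g ω ^ 2 ∂μ := by
  have hfg : Integrable (fun ω ↦ f ω * g ω) μ := hf.integrable_mul hg
  -- The integral of `(t * g + f) ^ 2` is a nonnegative quadratic polynomial in `t`.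
  have h (t : ℝ) : 0 ≤ (∫ ω, g ω ^ 2 ∂μ) * (t * t) + (2 * ∫ ω, f ω * g ω ∂μ) * t +
      ∫ ω, f ω ^ 2 ∂μ := by
    have h0 : 0 ≤ ∫ ω, (t ^ 2 * g ω ^ 2 + 2 * t * (f ω * g ω) + f ω ^ 2) ∂μ := by
      refine integral_nonneg fun ω ↦ ?_
      have : t ^ 2 * g ω ^ 2 + 2 * t * (f ω * g ω) + f ω ^ 2 = (t * g ω + f ω) ^ 2 := by ring
      simp only [Pi.zero_apply]
      rw [this]
      positivity
    rw [integral_add ((hg.integrable_sq.const_mul _).fun_add (hfg.const_mul _)) hf.integrable_sq,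
      integral_add (hg.integrable_sq.const_mul _) (hfg.const_mul _), integral_const_mul,
      integral_const_mul] at h0
    linarith
  have := discrim_le_zero h
  unfold discrim at this
  linarith

/-- Second moments are continuous with respect to mean-square approximation. -/
lemma tendsto_integral_sq_of_sub {f g : ℕ → Ω → ℝ} {c : ℝ} (hf : ∀ n, MemLp (f n) 2 μ)
    (hg : ∀ n, MemLp (g n) 2 μ) (hfc : Tendsto (fun n ↦ ∫ ω, f n ω ^ 2 ∂μ) atTop (𝓝 c))
    (hfg : Tendsto (fun n ↦ ∫ ω, (g n ω - f n ω) ^ 2 ∂μ) atTop (𝓝 0)) :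
    Tendsto (fun n ↦ ∫ ω, g n ω ^ 2 ∂μ) atTop (𝓝 c) := by
  have hd n : MemLp (fun ω ↦ g n ω - f n ω) 2 μ := (hg n).sub (hf n)
  have hcross : Tendsto (fun n ↦ ∫ ω, f n ω * (g n ω - f n ω) ∂μ) atTop (𝓝 0) := by
    have hsq : Tendsto (fun n ↦ (∫ ω, f n ω * (g n ω - f n ω) ∂μ) ^ 2) atTop (𝓝 0) := by
      have := hfc.mul hfg
      rw [mul_zero] at this
      exact squeeze_zero (fun n ↦ sq_nonneg _) (fun n ↦ sq_integral_mul_le (hf n) (hd n)) this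
    have := (Real.continuous_sqrt.tendsto 0).comp hsq
    simp only [Function.comp_def, Real.sqrt_sq_eq_abs, Real.sqrt_zero] at this
    exact (tendsto_zero_iff_abs_tendsto_zero _).2 this
  have h := (hfc.add (hcross.const_mul 2)).add hfg
  simp only [mul_zero, add_zero] at h
  refine h.congr fun n ↦ ?_
  have I1 : Integrable (fun ω ↦ f n ω * (g n ω - f n ω)) μ := (hf n).integrable_mul (hd n)
  rw [← integral_const_mul, ← integral_add (hf n).integrable_sq (I1.const_mul 2),
    ← integral_add ((hf n).integrable_sq.fun_add (I1.const_mul 2)) (hd n).integrable_sq]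
  refine integral_congr_ae (ae_of_all _ fun ω ↦ ?_)
  ring

end MeanSquare

/-! ### The empirical optimum -/

section EmpiricalOptimum

variable {V : Type*} [DecidableEq V]

lemma mem_uniqueOptimumEvent_iff [Fintype V] [Nonempty V] {Ω : Type*} {k T : ℕ} {X Y : ℕ → Ω → V}
    {ω : Ω} :
    ω ∈ uniqueOptimumEvent k T X Y ↔ ∀ u, 0 < occurrences (fun i ↦ X i ω) T u ∧
      0 < occurrences (fun i ↦ Y i ω) (k * T) u :=
  existsUnique_isMaximizer_empiricalObjective_iff

/-- A coordinate of `√T (θ_T - θ*)` on the event that the empirical optimum is unique, continued by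
`0` outside of it, where nothing is known about `θ_T`. -/
noncomputable def truncatedError {V Ω : Type*} (k : ℕ) (X Y : ℕ → Ω → V)
    (θ : ℕ → Ω → EuclideanSpace ℝ V) (θstar : EuclideanSpace ℝ V) (u : V) (T : ℕ) : Ω → ℝ :=
  (uniqueOptimumEvent k T X Y).indicator fun ω ↦ √(T : ℝ) * (θ T ω u - θstar u)

variable [Fintype V] {Ω : Type*} [MeasurableSpace Ω] {μ : Measure Ω} {pd pn : PMF V} {k : ℕ}
  {X Y : ℕ → Ω → V}
  {θstar : EuclideanSpace ℝ V} {θ : ℕ → Ω → EuclideanSpace ℝ V}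

/-- All that the limit theorems use about `θ T`, apart from its measurability: it is almost surely
close to its linearization, with an error controlled by the relative errors of the empirical
frequencies. -/
lemma sq_truncatedError_sub_linearError_le [Nonempty V] (hpd : ∀ u, 0 < (pd u).toReal)
    (hpn : ∀ u, 0 < (pn u).toReal) (hk : 1 ≤ k) (hθstar : IsMaximizer (objective pd pn k) θstar)
    (hθ : ∀ T, ∀ᵐ ω ∂μ,
      (∃ ϑ, IsMaximizer (empiricalObjective k T (fun i => X i ω) (fun i => Y i ω)) ϑ) →
      IsMaximizer (empiricalObjective k T (fun i => X i ω) (fun i => Y i ω)) (θ T ω))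
    (u : V) (T : ℕ) :
    ∀ᵐ ω ∂μ, (truncatedError k X Y θ θstar u T ω -
        linearError pd pn k T (fun i ↦ X i ω) (fun i ↦ Y i ω) u) ^ 2 ≤
      T * remainderConst pd pn k T u *
        quarticError pd pn k T (fun i ↦ X i ω) (fun i ↦ Y i ω) := by
  filter_upwards [hθ T] with ω hω
  refine sq_sub_linearError_le hpd hpn hk (fun h ↦ ?_) fun h ↦ ?_
  · have hmem : ω ∈ uniqueOptimumEvent k T X Y := mem_uniqueOptimumEvent_iff.2 h
    have hmax := hω (ExistsUnique.exists hmem)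
    rw [truncatedError, Set.indicator_of_mem hmem,
      (isMaximizer_empiricalObjective_iff (fun u ↦ (h u).1) fun u ↦ (h u).2).1 hmax,
      (isMaximizer_objective_iff hpd hpn hk).1 hθstar]
  · rw [truncatedError, Set.indicator_of_notMem]
    rwa [mem_uniqueOptimumEvent_iff]

/-- On the event that the empirical optimum is unique, the rescaled error differs from its linear
part by a quantity which tends to `0` in mean square, and the complement has vanishing
probability. -/
lemma tendstoInMeasure_sub_linearError [IsFiniteMeasure μ]
    (hlin : ∀ u T, MemLp (fun ω ↦ linearError pd pn k T (fun i ↦ X i ω) (fun i ↦ Y i ω) u) 2 μ)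
    (htr : ∀ u T, MemLp (truncatedError k X Y θ θstar u T) 2 μ)
    (hE : Tendsto (fun T ↦ μ.real (uniqueOptimumEvent k T X Y)ᶜ) atTop (𝓝 0))
    (hsq : ∀ u, Tendsto (fun T : ℕ ↦ ∫ ω, (truncatedError k X Y θ θstar u T ω -
      linearError pd pn k T (fun i ↦ X i ω) (fun i ↦ Y i ω) u) ^ 2 ∂μ) atTop (𝓝 0)) :
    TendstoInMeasure μ ((fun (T : ℕ) ω ↦ √(T : ℝ) • (θ T ω - θstar)) -
      fun T ω ↦ linearError pd pn k T (fun i ↦ X i ω) (fun i ↦ Y i ω)) atTop 0 := by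
  rw [tendstoInMeasure_iff_measureReal_norm]
  intro ε hε
  let d (T : ℕ) (u : V) (ω : Ω) : ℝ := truncatedError k X Y θ θstar u T ω -
    linearError pd pn k T (fun i ↦ X i ω) (fun i ↦ Y i ω) u
  have hint (T : ℕ) (u : V) : Integrable (fun ω ↦ d T u ω ^ 2) μ :=
    ((htr u T).sub (hlin u T)).integrable_sq
  have hlim : Tendsto (fun T ↦ μ.real (uniqueOptimumEvent k T X Y)ᶜ +
      (∑ u, ∫ ω, d T u ω ^ 2 ∂μ) / ε ^ 2) atTop (𝓝 0) := by
    have h1 := tendsto_finsetSum Finset.univ fun u _ ↦ hsq u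
    have h2 := hE.add (h1.div_const (ε ^ 2))
    simpa using h2
  refine squeeze_zero (fun T ↦ measureReal_nonneg) (fun T ↦ ?_) hlim
  have hsub : {ω | ε ≤ ‖((fun (T : ℕ) ω ↦ √(T : ℝ) • (θ T ω - θstar)) -
      fun T ω ↦ linearError pd pn k T (fun i ↦ X i ω) (fun i ↦ Y i ω)) T ω -
        (0 : Ω → EuclideanSpace ℝ V) ω‖} ⊆
      (uniqueOptimumEvent k T X Y)ᶜ ∪ {ω | ε ^ 2 ≤ ∑ u, d T u ω ^ 2} := by
    intro ω hω
    by_cases h : ω ∈ uniqueOptimumEvent k T X Y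
    · right
      have hω' : ε ^ 2 ≤ ‖√(T : ℝ) • (θ T ω - θstar) -
          linearError pd pn k T (fun i ↦ X i ω) (fun i ↦ Y i ω)‖ ^ 2 := by
        have : ε ≤ ‖√(T : ℝ) • (θ T ω - θstar) -
          linearError pd pn k T (fun i ↦ X i ω) (fun i ↦ Y i ω)‖ := by simpa using hω
        gcongr
      rw [EuclideanSpace.real_norm_sq_eq] at hω'
      refine hω'.trans (Finset.sum_le_sum fun u _ ↦ ?_)
      simp [d, truncatedError, Set.indicator_of_mem h]
    · exact Or.inl h
  refine (measureReal_mono hsub).trans ((measureReal_union_le _ _).trans ?_)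
  gcongr
  rw [le_div_iff₀' (by positivity), ← integral_finsetSum _ fun u _ ↦ hint T u]
  exact mul_meas_ge_le_integral_of_nonneg
    (ae_of_all _ fun ω ↦ Finset.sum_nonneg fun u _ ↦ sq_nonneg _)
    (integrable_finsetSum _ fun u _ ↦ hint T u) _

variable [MeasurableSpace V] [MeasurableSingletonClass V]

lemma aemeasurable_occurrences {Z : ℕ → Ω → V} (hZ : ∀ i, AEMeasurable (Z i) μ) (n : ℕ) (u : V) :
    AEMeasurable (fun ω ↦ occurrences (fun i ↦ Z i ω) n u) μ :=
  Finset.aemeasurable_fun_sum _ fun i _ ↦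
    (measurable_of_finite fun v : V ↦ if v = u then 1 else 0).comp_aemeasurable (hZ i)

lemma nullMeasurableSet_uniqueOptimumEvent [Nonempty V] (hX : ∀ i, AEMeasurable (X i) μ)
    (hY : ∀ i, AEMeasurable (Y i) μ) (T : ℕ) :
    NullMeasurableSet (uniqueOptimumEvent k T X Y) μ := by
  have : uniqueOptimumEvent k T X Y = ⋂ u, ({ω | 0 < occurrences (fun i ↦ X i ω) T u} ∩
      {ω | 0 < occurrences (fun i ↦ Y i ω) (k * T) u}) := by
    ext ω
    simp [mem_uniqueOptimumEvent_iff]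
  rw [this]
  exact .iInter fun u ↦
    (nullMeasurableSet_lt aemeasurable_const (aemeasurable_occurrences hX T u)).inter
    (nullMeasurableSet_lt aemeasurable_const (aemeasurable_occurrences hY (k * T) u))

lemma aemeasurable_truncatedError [Nonempty V] (hX : ∀ i, AEMeasurable (X i) μ)
    (hY : ∀ i, AEMeasurable (Y i) μ) (hθ : ∀ T, AEMeasurable (θ T) μ) (u : V) (T : ℕ) :
    AEMeasurable (truncatedError k X Y θ θstar u T) μ := by
  have h : AEMeasurable (fun ω ↦ θ T ω u) μ :=
    (EuclideanSpace.proj (𝕜 := ℝ) u).continuous.measurable.comp_aemeasurable (hθ T)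
  exact ((h.sub_const _).const_mul _).indicator₀ (nullMeasurableSet_uniqueOptimumEvent hX hY T)

lemma mul_integral_cond_uniqueOptimumEvent [Nonempty V] (hX : ∀ i, AEMeasurable (X i) μ)
    (hY : ∀ i, AEMeasurable (Y i) μ) (u : V) (T : ℕ) :
    T * ∫ ω, (θ T ω u - θstar u) ^ 2 ∂(cond μ (uniqueOptimumEvent k T X Y)) =
      (μ.real (uniqueOptimumEvent k T X Y))⁻¹ *
        ∫ ω, truncatedError k X Y θ θstar u T ω ^ 2 ∂μ := by
  have hE := nullMeasurableSet_uniqueOptimumEvent (k := k) hX hY T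
  have e (ω : Ω) : truncatedError k X Y θ θstar u T ω ^ 2 =
      (uniqueOptimumEvent k T X Y).indicator (fun ω ↦ T * (θ T ω u - θstar u) ^ 2) ω := by
    by_cases h : ω ∈ uniqueOptimumEvent k T X Y
    · simp [truncatedError, Set.indicator_of_mem h, mul_pow]
    · simp [truncatedError, Set.indicator_of_notMem h]
  simp_rw [e]
  rw [integral_indicator₀ hE, integral_const_mul, ProbabilityTheory.cond, integral_smul_measure,
    ENNReal.toReal_inv, smul_eq_mul, measureReal_def]
  ring

lemma integrable_cond_uniqueOptimumEvent [Nonempty V] (hX : ∀ i, AEMeasurable (X i) μ)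
    (hY : ∀ i, AEMeasurable (Y i) μ) {u : V} {T : ℕ}
    (htr : MemLp (truncatedError k X Y θ θstar u T) 2 μ) :
    Integrable (fun ω ↦ (θ T ω u - θstar u) ^ 2) (cond μ (uniqueOptimumEvent k T X Y)) := by
  by_cases h0 : μ (uniqueOptimumEvent k T X Y) = 0
  · rw [cond_eq_zero_of_meas_eq_zero h0]
    exact integrable_zero_measure
  -- Without samples every `θ` maximizes the empirical objective, so the event is empty.
  have hT : T ≠ 0 := by
    rintro rfl
    refine h0 ?_
    have : uniqueOptimumEvent k 0 X Y = ∅ := by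
      ext ω
      simp [mem_uniqueOptimumEvent_iff, occurrences]
    rw [this, measure_empty]
  have hT' : (0 : ℝ) < T := by positivity
  refine Integrable.smul_measure ?_ (ENNReal.inv_ne_top.2 h0)
  have hE := nullMeasurableSet_uniqueOptimumEvent (k := k) hX hY T
  refine (htr.integrable_sq.const_mul (T : ℝ)⁻¹).restrict.congr
    ((ae_restrict_iff'₀ hE).2 (ae_of_all _ fun ω h ↦ ?_))
  simp only [truncatedError, Set.indicator_of_mem h, mul_pow, Real.sq_sqrt hT'.le]
  field_simp

variable [IsProbabilityMeasure μ]

lemma memLp_linearError (hpd : ∀ u, 0 < (pd u).toReal) (hpn : ∀ u, 0 < (pn u).toReal)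
    (hX : ∀ i, AEMeasurable (X i) μ) (hY : ∀ i, AEMeasurable (Y i) μ) (u : V) (T : ℕ) :
    MemLp (fun ω ↦ linearError pd pn k T (fun i ↦ X i ω) (fun i ↦ Y i ω) u) 2 μ := by
  have hm (p : PMF V) (hp : ∀ u, 0 < (p u).toReal) (Z : ℕ → Ω → V) (hZ : ∀ i, AEMeasurable (Z i) μ)
      (n : ℕ) : MemLp (fun ω ↦ freqError p (fun i ↦ Z i ω) n u) 2 μ :=
    MemLp.of_bound (aemeasurable_freqError hZ n u).aestronglyMeasurable _
      (ae_of_all _ fun ω ↦ abs_freqError_le _ n (hp u))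
  simp_rw [linearError_apply]
  exact ((hm pd hpd X hX T).sub (hm pn hpn Y hY (k * T))).const_mul _

lemma memLp_truncatedError [Nonempty V] (hpd : ∀ u, 0 < (pd u).toReal)
    (hpn : ∀ u, 0 < (pn u).toReal) (hX : ∀ i, HasLaw (X i) pd.toMeasure μ)
    (hY : ∀ i, HasLaw (Y i) pn.toMeasure μ) (hθm : ∀ T, AEMeasurable (θ T) μ) {u : V} {T : ℕ}
    (hle : ∀ᵐ ω ∂μ, (truncatedError k X Y θ θstar u T ω -
        linearError pd pn k T (fun i ↦ X i ω) (fun i ↦ Y i ω) u) ^ 2 ≤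
      T * remainderConst pd pn k T u *
        quarticError pd pn k T (fun i ↦ X i ω) (fun i ↦ Y i ω)) :
    MemLp (truncatedError k X Y θ θstar u T) 2 μ := by
  have hX' i := (hX i).aemeasurable
  have hY' i := (hY i).aemeasurable
  have hlin := memLp_linearError (k := k) hpd hpn hX' hY' u T
  have hd : MemLp (fun ω ↦ truncatedError k X Y θ θstar u T ω -
      linearError pd pn k T (fun i ↦ X i ω) (fun i ↦ Y i ω) u) 2 μ := by
    have hm := (aemeasurable_truncatedError (k := k) (θstar := θstar) hX' hY' hθm u T).sub
      hlin.aemeasurable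
    refine (memLp_two_iff_integrable_sq hm.aestronglyMeasurable).2 ?_
    refine ((integrable_quarticError (k := k) hpd hpn hX hY T).const_mul
      (T * remainderConst pd pn k T u)).mono' (hm.pow_const 2).aestronglyMeasurable ?_
    filter_upwards [hle] with ω hω
    rw [Real.norm_eq_abs, abs_of_nonneg (sq_nonneg _)]
    exact hω
  convert hd.add hlin using 1
  ext ω
  simp

/-- The linearization error tends to `0` in mean square: it is of order `(log T) ^ 2 / T`. -/
lemma tendsto_integral_sq_truncatedError_sub (hpd : ∀ u, 0 < (pd u).toReal)
    (hpn : ∀ u, 0 < (pn u).toReal) (hk : 1 ≤ k) (hX : ∀ i, HasLaw (X i) pd.toMeasure μ)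
    (hY : ∀ i, HasLaw (Y i) pn.toMeasure μ)
    (hindep : iIndepFun (fun i : ℕ ⊕ ℕ => Sum.elim X Y i) μ) {u : V}
    (hle : ∀ T : ℕ, ∀ᵐ ω ∂μ, (truncatedError k X Y θ θstar u T ω -
        linearError pd pn k T (fun i ↦ X i ω) (fun i ↦ Y i ω) u) ^ 2 ≤
      T * remainderConst pd pn k T u *
        quarticError pd pn k T (fun i ↦ X i ω) (fun i ↦ Y i ω)) :
    Tendsto (fun T : ℕ ↦ ∫ ω, (truncatedError k X Y θ θstar u T ω -
      linearError pd pn k T (fun i ↦ X i ω) (fun i ↦ Y i ω) u) ^ 2 ∂μ) atTop (𝓝 0) := by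
  have h := (tendsto_remainderConst_div pd pn hk u).mul_const
    (∑ u, (3 / (pd u).toReal ^ 4 + 3 / (pn u).toReal ^ 4))
  rw [zero_mul] at h
  refine squeeze_zero' (.of_forall fun T ↦ integral_nonneg fun ω ↦ sq_nonneg _) ?_ h
  filter_upwards [eventually_ne_atTop 0] with T hT
  have hT' : (0 : ℝ) < T := by positivity
  have hR : 0 ≤ remainderConst pd pn k T u := by unfold remainderConst; positivity
  calc _ ≤ ∫ ω, T * remainderConst pd pn k T u *
        quarticError pd pn k T (fun i ↦ X i ω) (fun i ↦ Y i ω) ∂μ :=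
        integral_mono_of_nonneg (ae_of_all _ fun ω ↦ sq_nonneg _)
          ((integrable_quarticError hpd hpn hX hY T).const_mul _) (hle T)
    _ ≤ T * remainderConst pd pn k T u *
        ((∑ u, (3 / (pd u).toReal ^ 4 + 3 / (pn u).toReal ^ 4)) / T ^ 2) := by
      rw [integral_const_mul]
      exact mul_le_mul_of_nonneg_left (integral_quarticError_le hpd hpn hk hX hY hindep hT)
        (by positivity)
    _ = _ := by field_simp

lemma tendsto_measureReal_compl_uniqueOptimumEvent [Nonempty V] (hpd : ∀ u, 0 < (pd u).toReal)
    (hpn : ∀ u, 0 < (pn u).toReal) (hk : 1 ≤ k) (hX : ∀ i, HasLaw (X i) pd.toMeasure μ)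
    (hY : ∀ i, HasLaw (Y i) pn.toMeasure μ)
    (hindep : iIndepFun (fun i : ℕ ⊕ ℕ => Sum.elim X Y i) μ) :
    Tendsto (fun T ↦ μ.real (uniqueOptimumEvent k T X Y)ᶜ) atTop (𝓝 0) := by
  have h : Tendsto (fun T : ℕ ↦ (∑ u, (3 / (pd u).toReal ^ 4 + 3 / (pn u).toReal ^ 4)) /
      (T : ℝ) ^ 2) atTop (𝓝 0) :=
    ((tendsto_pow_atTop two_ne_zero).comp tendsto_natCast_atTop_atTop).const_div_atTop _
  refine squeeze_zero' (.of_forall fun T ↦ measureReal_nonneg) ?_ h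
  filter_upwards [eventually_ne_atTop 0] with T hT
  refine le_trans ?_ (integral_quarticError_le hpd hpn hk hX hY hindep hT)
  have hM := mul_meas_ge_le_integral_of_nonneg
    (ae_of_all _ fun ω ↦ quarticError_nonneg pd pn k T (fun i ↦ X i ω) (fun i ↦ Y i ω))
    (integrable_quarticError (k := k) hpd hpn hX hY T) 1
  rw [one_mul] at hM
  refine le_trans (measureReal_mono fun ω hω ↦ ?_) hM
  exact one_le_quarticError pd pn (mem_uniqueOptimumEvent_iff.not.1 hω)

end EmpiricalOptimum

end SampledNCE

theorem theorem2 {V : Type*} [Fintype V] [DecidableEq V]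
    [MeasurableSpace V] [MeasurableSingletonClass V]
    {Ω : Type*} [MeasurableSpace Ω] (μ : Measure Ω) [IsProbabilityMeasure μ]
    -- the positive and negative distributions of the fixed node, and the negative ratio `k`
    (pd pn : PMF V) (hpd : ∀ u, 0 < pd u) (hpn : ∀ u, 0 < pn u) (k : ℕ) (hk : 1 ≤ k)
    -- independent positive samples `X i` from `pd` and negative samples `Y i` from `pn`
    (X Y : ℕ → Ω → V)
    (hX : ∀ i, HasLaw (X i) pd.toMeasure μ) (hY : ∀ i, HasLaw (Y i) pn.toMeasure μ)
    (hindep : iIndepFun (fun i : ℕ ⊕ ℕ => Sum.elim X Y i) μ)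
    -- the population optimum
    (θstar : EuclideanSpace ℝ V)
    (hθstar : SampledNCE.IsMaximizer (SampledNCE.objective pd pn k) θstar)
    -- the empirical optimum: a maximizer whenever there is one
    (θ : ℕ → Ω → EuclideanSpace ℝ V) (hθ_meas : ∀ T, AEMeasurable (θ T) μ)
    (hθ : ∀ T, ∀ᵐ ω ∂μ,
      (∃ ϑ, SampledNCE.IsMaximizer
        (SampledNCE.empiricalObjective k T (fun i => X i ω) (fun i => Y i ω)) ϑ) →
      SampledNCE.IsMaximizer
        (SampledNCE.empiricalObjective k T (fun i => X i ω) (fun i => Y i ω)) (θ T ω)) :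
    -- with probability tending to one, the empirical optimum exists and is unique
    Tendsto (fun T => μ.real (SampledNCE.uniqueOptimumEvent k T X Y)) atTop (𝓝 1) ∧
    -- limit law of `√T (θ_T - θ*)`, with its mean and its covariance matrix
    (∃ (ν : Measure (EuclideanSpace ℝ V)) (_ : IsProbabilityMeasure ν),
      TendstoInDistribution (fun (T : ℕ) ω => √(T : ℝ) • (θ T ω - θstar)) atTop
        (fun z : EuclideanSpace ℝ V => z) (fun _ => μ) ν ∧
      MemLp (fun z : EuclideanSpace ℝ V => z) 2 ν ∧
      ∫ z, z ∂ν = 0 ∧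
      ∀ u w, cov[fun z : EuclideanSpace ℝ V => z u, fun z : EuclideanSpace ℝ V => z w; ν] =
        SampledNCE.asymptoticCovariance pd pn k u w) ∧
    -- the mean squared error of `θ_u`, to leading order in `1 / T`
    (∀ u,
      (∀ T, Integrable (fun ω => (θ T ω u - θstar u) ^ 2)
        (ProbabilityTheory.cond μ (SampledNCE.uniqueOptimumEvent k T X Y))) ∧
      Tendsto (fun T : ℕ => (T : ℝ) * ∫ ω, (θ T ω u - θstar u) ^ 2
          ∂(ProbabilityTheory.cond μ (SampledNCE.uniqueOptimumEvent k T X Y))) atTop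
        (𝓝 (1 / (pd u).toReal - 1 + 1 / (k * (pn u).toReal) - 1 / (k : ℝ)))) := by
  have hpd' u : 0 < (pd u).toReal := ENNReal.toReal_pos (hpd u).ne' (pd.apply_ne_top u)
  have hpn' u : 0 < (pn u).toReal := ENNReal.toReal_pos (hpn u).ne' (pn.apply_ne_top u)
  have : Nonempty V := ⟨pd.support_nonempty.some⟩
  have hX' i := (hX i).aemeasurable
  have hY' i := (hY i).aemeasurable
  have hle := SampledNCE.sq_truncatedError_sub_linearError_le hpd' hpn' hk hθstar hθ
  have hlin := SampledNCE.memLp_linearError (k := k) hpd' hpn' hX' hY'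
  have htr u T := SampledNCE.memLp_truncatedError hpd' hpn' hX hY hθ_meas (hle u T)
  have hsq u := SampledNCE.tendsto_integral_sq_truncatedError_sub hpd' hpn' hk hX hY hindep (hle u)
  have hEc := SampledNCE.tendsto_measureReal_compl_uniqueOptimumEvent hpd' hpn' hk hX hY hindep
  have hE : Tendsto (fun T => μ.real (SampledNCE.uniqueOptimumEvent k T X Y)) atTop (𝓝 1) := by
    have h := hEc.const_sub 1
    rw [sub_zero] at h
    refine h.congr fun T ↦ ?_
    rw [measureReal_compl₀ (SampledNCE.nullMeasurableSet_uniqueOptimumEvent hX' hY' T),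
      probReal_univ, sub_sub_cancel]
  refine ⟨hE, ⟨multivariateGaussian 0 (SampledNCE.asymptoticCovariance pd pn k), inferInstance,
    ?_, IsGaussian.memLp_two_id, integral_id_multivariateGaussian, fun u w ↦
      covariance_eval_multivariateGaussian
        (SampledNCE.posSemidef_asymptoticCovariance hpd' hpn' hk) u w⟩, fun u ↦ ⟨fun T ↦
      SampledNCE.integrable_cond_uniqueOptimumEvent hX' hY' (htr u T), ?_⟩⟩
  · exact tendstoInDistribution_of_tendstoInMeasure_sub _ _
      (SampledNCE.tendstoInDistribution_linearError hpd' hpn' hk hX hY hindep)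
      (SampledNCE.tendstoInMeasure_sub_linearError hlin htr hEc hsq)
      fun T ↦ ((hθ_meas T).sub_const θstar).fun_const_smul _
  · have hlim := SampledNCE.tendsto_integral_sq_of_sub (hlin u) (htr u)
      (tendsto_const_nhds.congr' ((eventually_ne_atTop 0).mono fun T hT ↦
        (SampledNCE.integral_linearError_sq hpd' hpn' hk hX hY hindep hT u).symm)) (hsq u)
    have h := (hE.inv₀ one_ne_zero).mul hlim
    rw [inv_one, one_mul] at h
    exact h.congr fun T ↦ (SampledNCE.mul_integral_cond_uniqueOptimumEvent hX' hY' u T).symm
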